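/- All hypergraphs are finite and may have parallel edges but no loops: a hypergraph $H$ consists of a finite vertex set $V(H)$, a finite edge set $E(H)$ and an incidence function $i_H$ assigning to each edge $e$ a set $i_H(e)\subseteq V(H)$ with $|i_H(e)|\ge 2$. The degree $d_H(v)$ is the number of edges $e$ with $v\in i_H(e)$, and $\Delta(H)=\max_{v\in V(H)} d_H(v)$. A non-empty $H$ is connected if for every $\varnothing\ne X\subsetneq V(H)$ some edge contains a vertex of $X$ and a vertex of $V(H)\setminus X$. A subhypergraph of $H$ is a hypergraph $H'$ with $V(H')\subseteq V(H)$, $E(H')\subseteq E(H)$ and $i_{H'}=i_H|_{E(H')}$; the subhypergraph $H[X]$ induced by $X\subseteq V(H)$ has vertex set $X$ and edge set $\{e\in E(H): i_H(e)\subseteq X\}$. For an integer $s\ge 0$, $H$ is strictly $s$-degenerate if every non-empty subhypergraph $H'$ of $H$ has a vertex $v$ with $d_{H'}(v)<s$. For a simple graph $G$ and $t\ge1$, $tG$ is obtained from $G$ by replacing each edge by $t$ parallel edges; $K_n$ is the complete graph and $C_n$ the cycle on $n$ vertices. **Corollary.** Let $H$ be a connected hypergraph that is not isomorphic to $tK_n$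 for any $t,n\ge 1$ and not isomorphic to $tC_n$ for any $t\ge 1$ and odd $n\ge 3$, and let $\Delta(H)\ge 1$. Let $k$ and $s$ be integers with $k\ge 2$ and $k\cdot s\ge \Delta(H)$ (so that $s\ge 1$). Let $C$ be a set of colors and let $L$ assign to each $v\in V(H)$ a set $L(v)\subseteq C$ with $|L(v)|\ge k$. Then there is a coloring $\varphi:V(H)\to C$ with $\varphi(v)\in L(v)$ for all $v\in V(H)$ such that, for every color $c\in C$, the induced subhypergraph $H[\varphi^{-1}(c)]$ is strictly $s$-degenerate. -/

import Mathlib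

/-- A finite hypergraph, possibly with parallel edges but without loops, whose vertices lie in `α`
and whose edges lie in `β`. The incidence function is only meaningful on `edges`. -/
structure MultiHypergraph (α β : Type*) where
  /-- the vertex set `V(H)` -/
  verts : Finset α
  /-- the edge set `E(H)` -/
  edges : Finset β
  /-- the incidence function `i_H` -/
  inc : β → Finset α
  inc_subset : ∀ e ∈ edges, inc e ⊆ verts
  two_le_card_inc : ∀ e ∈ edges, 2 ≤ (inc e).card

namespace MultiHypergraph

variable {α β : Type*}

/-- The hypergraph without vertices and edges. -/
def IsEmptyHypergraph (H : MultiHypergraph α β) : Prop :=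
  H.verts = ∅ ∧ H.edges = ∅

/-- `G` is a subhypergraph of `H`. -/
def IsSubhypergraph (G H : MultiHypergraph α β) : Prop :=
  G.verts ⊆ H.verts ∧ G.edges ⊆ H.edges ∧ ∀ e ∈ G.edges, G.inc e = H.inc e

open Classical in
/-- `H[X]`, the subhypergraph of `H` induced by a set `X` of vertices of `H`. -/
noncomputable def induce (H : MultiHypergraph α β) (X : Finset α) : MultiHypergraph α β where
  verts := H.verts.filter (fun v => v ∈ X)
  edges := H.edges.filter (fun e => H.inc e ⊆ X)
  inc := H.inc
  inc_subset := by
    intro e he v hv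
    rw [Finset.mem_filter] at he ⊢
    exact ⟨H.inc_subset e he.1 hv, he.2 hv⟩
  two_le_card_inc := by
    intro e he
    exact H.two_le_card_inc e (Finset.mem_filter.mp he).1

open Classical in
/-- The degree `d_H(v)`: the number of edges incident with `v`. -/
noncomputable def degree (H : MultiHypergraph α β) (v : α) : ℕ :=
  (H.edges.filter (fun e => v ∈ H.inc e)).card

/-- The maximum degree `Δ(H)` (it is `0` for the empty hypergraph). -/
noncomputable def maxDegree (H : MultiHypergraph α β) : ℕ :=
  H.verts.sup H.degree

/-- `H` is non-empty, and for every non-empty proper subset `X` of `V(H)` some edge contains a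
vertex of `X` as well as a vertex of `V(H) \ X`. -/
def Connected (H : MultiHypergraph α β) : Prop :=
  ¬ H.IsEmptyHypergraph ∧
    ∀ X : Finset α, X.Nonempty → X ⊂ H.verts →
      ∃ e ∈ H.edges, (∃ u ∈ H.inc e, u ∈ X) ∧ (∃ w ∈ H.inc e, w ∉ X)

/-- Every non-empty subhypergraph `G` of `H` contains a vertex `v` with `d_G(v) < s`. -/
def StrictlyDegenerate (H : MultiHypergraph α β) (s : ℕ) : Prop :=
  ∀ G : MultiHypergraph α β, G.IsSubhypergraph H → ¬ G.IsEmptyHypergraph →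
    ∃ v ∈ G.verts, G.degree v < s

open Classical in
/-- The multiplicity `μ_H(u, v)`: the number of ordinary edges joining `u` and `v`. -/
noncomputable def edgeMultiplicity (H : MultiHypergraph α β) (u v : α) : ℕ :=
  (H.edges.filter (fun e => (H.inc e : Set α) = {u, v})).card

open Classical in
/-- `H = tG` up to isomorphism, where `tG` arises from the simple graph `G` by replacing each edge
by `t` parallel edges: all edges of `H` are ordinary, and under a bijection between the vertex
sets, adjacent vertices of `G` are joined by exactly `t` edges of `H` and non-adjacent ones by
none. -/
def IsMultipleOf (H : MultiHypergraph α β) (t : ℕ) {W : Type*} (G : SimpleGraph W) : Prop :=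
  (∀ e ∈ H.edges, (H.inc e).card = 2) ∧
    ∃ σ : W ≃ {v : α // v ∈ H.verts}, ∀ x y : W, x ≠ y →
      H.edgeMultiplicity (σ x) (σ y) = if G.Adj x y then t else 0

open Classical in
/-- The color class of the color `c` with respect to the coloring `φ` of `H`. -/
noncomputable def colorClass (H : MultiHypergraph α β) {C : Type*} (φ : α → C) (c : C) : Finset α :=
  H.verts.filter (fun v => φ v = c)

end MultiHypergraph

/-! Fix `k` colors in each list, give them capacity `s` at that vertex, and give all other colors
capacity 0. The capacities at a vertex then add up to `k * s`, which is at least its degree, and it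
suffices to find a coloring that is good in the sense of `GoodOn`.

Suppose there is none. Connectedness allows everything except one chosen vertex `x` to be colored
greedily. No color extends to `x`, so counting the edges at `x` makes every inequality tight
(`Critical.card_monoEdges`): each edge at `x` is monochromatic apart from `x`, and exactly `f x c`
of them have color `c`. Hence `x` may take the color of a neighbor, which becomes uncolored instead
(`Critical.shift`). This is a sliding puzzle: the hole travels along any walk, and comparing color
counts before and after a closed walk makes the structure rigid.

If there is no cut vertex, all edges have size 2 (`Critical.card_inc`), and a vertex not adjacent to
all others has exactly two neighbors (`CriticalBlock.exists_neighbor_pair`). This leaves multiples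
of complete graphs and of cycles. Even cycles have a proper 2-coloring, and the other cases are
excluded by hypothesis.

Cut vertices cannot occur (`Critical.nonSeparable`). A smallest piece cut off by a vertex `v`, taken
together with `v` and with reduced capacities at `v`, is again critical and has no cut vertex, so it
is regular. Its other vertices have degree `k * s`, so `v`, which has further edges outside the
piece, has too large a degree. -/

namespace MultiHypergraph

/-! ### Good colorings with one uncolored vertex, and how that vertex moves -/

section Transport

open Classical

variable {α β C : Type*}

/-- The number of edges of `H` at `u` that lie inside `X`. -/
noncomputable def degIn (H : MultiHypergraph α β) (X : Finset α) (u : α) : ℕ :=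
  (H.edges.filter (fun e => u ∈ H.inc e ∧ H.inc e ⊆ X)).card

/-- `φ` colors the vertex set `A` in such a way that the subhypergraph induced by the vertices of
color `c` is strictly `f · c`-degenerate, for every color `c`. -/
def GoodOn (H : MultiHypergraph α β) (f : α → C → ℕ) (A : Finset α) (φ : α → C) : Prop :=
  ∀ X ⊆ A, X.Nonempty → ∀ c, (∀ u ∈ X, φ u = c) → ∃ u ∈ X, H.degIn X u < f u c

/-- The degrees are bounded by the sums of the color capacities `f`, but `H` has no good
coloring. -/
structure Critical (H : MultiHypergraph α β) (f : α → C → ℕ) (P : Finset C) : Prop where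
  degree_le : ∀ x ∈ H.verts, H.degree x ≤ ∑ c ∈ P, f x c
  eq_zero : ∀ x ∈ H.verts, ∀ c, c ∉ P → f x c = 0
  not_good : ∀ φ : α → C, ¬ H.GoodOn f H.verts φ

/-- `φ` is a good coloring of `H` with the vertex `x` left uncolored. -/
def GoodOff (H : MultiHypergraph α β) (f : α → C → ℕ) (x : α) (φ : α → C) : Prop :=
  x ∈ H.verts ∧ H.GoodOn f (H.verts.erase x) φ

/-- The edges at `x` all of whose other vertices have color `c`. -/
noncomputable def monoEdges (H : MultiHypergraph α β) (φ : α → C) (x : α) (c : C) : Finset β :=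
  H.edges.filter (fun e => x ∈ H.inc e ∧ ∀ u ∈ H.inc e, u ≠ x → φ u = c)

/-- Two distinct vertices are adjacent if they lie in a common edge. -/
def Adj (H : MultiHypergraph α β) (u v : α) : Prop :=
  u ≠ v ∧ ∃ e ∈ H.edges, u ∈ H.inc e ∧ v ∈ H.inc e

/-- `v` can be reached from `u` by a walk that leaves only vertices in `W`. -/
def Reach (H : MultiHypergraph α β) (W : Set α) : α → α → Prop :=
  Relation.ReflTransGen (fun u v => u ∈ W ∧ H.Adj u v)

variable {H : MultiHypergraph α β} {f : α → C → ℕ} {P : Finset C} {φ : α → C} {x y z : α}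

theorem Adj.symm (h : H.Adj x y) : H.Adj y x :=
  ⟨h.1.symm, by obtain ⟨e, he, h1, h2⟩ := h.2; exact ⟨e, he, h2, h1⟩⟩

theorem Adj.mem_left (h : H.Adj x y) : x ∈ H.verts := by
  obtain ⟨e, he, h1, _⟩ := h.2
  exact H.inc_subset e he h1

theorem Adj.mem_right (h : H.Adj x y) : y ∈ H.verts := h.symm.mem_left

theorem exists_other {e : β} (he : e ∈ H.edges) (x : α) : ∃ u ∈ H.inc e, u ≠ x :=
  Finset.exists_mem_ne (by have := H.two_le_card_inc e he; omega) x

/-- A good coloring extends to a vertex at which some color is not yet used up. -/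
theorem GoodOn.insert {A : Finset α} {c : C} (h : H.GoodOn f A φ) (hx : x ∉ A)
    (hc : (H.edges.filter (fun e => x ∈ H.inc e ∧ H.inc e ⊆ insert x A ∧
      ∀ u ∈ H.inc e, u ≠ x → φ u = c)).card < f x c) :
    H.GoodOn f (insert x A) (Function.update φ x c) := by
  intro X hX hne c' hc'
  by_cases hxX : x ∈ X
  · refine ⟨x, hxX, ?_⟩
    have hcc : c = c' := by simpa using hc' x hxX
    subst hcc
    refine lt_of_le_of_lt (Finset.card_le_card ?_) hc
    intro e he
    rw [Finset.mem_filter] at he ⊢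
    refine ⟨he.1, he.2.1, he.2.2.trans hX, fun u hu hux => ?_⟩
    have := hc' u (he.2.2 hu)
    rwa [Function.update_of_ne hux] at this
  · have hXA : X ⊆ A := fun u hu => by
      rcases Finset.mem_insert.1 (hX hu) with rfl | h'
      · exact absurd hu hxX
      · exact h'
    refine h X hXA hne c' fun u hu => ?_
    have := hc' u hu
    rwa [Function.update_of_ne (by rintro rfl; exact hxX hu)] at this

theorem sum_card_le_card {ι : Type*} (P : Finset ι) (s : ι → Finset β) (t : Finset β)
    (hs : ∀ i ∈ P, s i ⊆ t)
    (hd : ∀ i ∈ P, ∀ j ∈ P, ∀ e, e ∈ s i → e ∈ s j → i = j) :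
    ∑ i ∈ P, (s i).card ≤ t.card := by
  rw [← Finset.card_biUnion]
  · exact Finset.card_le_card (Finset.biUnion_subset.2 hs)
  · intro i hi j hj hij
    refine Finset.disjoint_left.2 fun e h1 h2 => hij (hd i hi j hj e h1 h2)

theorem monoEdges_color_unique {c d : C} {e : β} (h1 : e ∈ H.monoEdges φ x c)
    (h2 : e ∈ H.monoEdges φ x d) : c = d := by
  rw [monoEdges, Finset.mem_filter] at h1 h2
  obtain ⟨u, hu, hux⟩ := exists_other h1.1 x
  rw [← h1.2.2 u hu hux, ← h2.2.2 u hu hux]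

theorem sum_monoEdges_le (x : α) : ∑ c ∈ P, (H.monoEdges φ x c).card ≤ H.degree x := by
  refine sum_card_le_card P _ _ (fun c _ e he => ?_)
    (fun c _ d _ e h1 h2 => monoEdges_color_unique h1 h2)
  rw [monoEdges, Finset.mem_filter] at he
  exact Finset.mem_filter.2 ⟨he.1, he.2.1⟩

/-- A set in which every subset is left by an edge can be colored greedily. -/
theorem exists_goodOn [Nonempty C] (hd : ∀ x ∈ H.verts, H.degree x ≤ ∑ c ∈ P, f x c)
    (A : Finset α) (hA : A ⊆ H.verts)
    (hout : ∀ X ⊆ A, X.Nonempty → ∃ e ∈ H.edges, (∃ u ∈ H.inc e, u ∈ X) ∧ ¬ H.inc e ⊆ X) :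
    ∃ φ : α → C, H.GoodOn f A φ := by
  induction A using Finset.strongInduction with
  | H A ih =>
    rcases A.eq_empty_or_nonempty with rfl | hne
    · refine ⟨fun _ => Classical.arbitrary C, fun X hX hX' => ?_⟩
      rw [Finset.subset_empty.1 hX] at hX'
      exact absurd hX' Finset.not_nonempty_empty
    · obtain ⟨e, he, ⟨x, hxe, hxA⟩, hesub⟩ := hout A subset_rfl hne
      obtain ⟨φ, hφ⟩ := ih (A.erase x) (Finset.erase_ssubset hxA)
        ((Finset.erase_subset _ _).trans hA)
        (fun X hX => hout X (hX.trans (Finset.erase_subset _ _)))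
      -- The edge `e` leaves `A`, so it blocks no color at `x`; this makes the count strictly
      -- smaller than the degree.
      have hlt : ∑ c ∈ P, (H.edges.filter (fun e => x ∈ H.inc e ∧ H.inc e ⊆ insert x (A.erase x) ∧
          ∀ u ∈ H.inc e, u ≠ x → φ u = c)).card < ∑ c ∈ P, f x c := by
        refine lt_of_lt_of_le (lt_of_le_of_lt (sum_card_le_card P _
          ((H.edges.filter (fun e => x ∈ H.inc e)).erase e) ?_ ?_)
          (Finset.card_erase_lt_of_mem (a := e) (Finset.mem_filter.2 ⟨he, hxe⟩))) (hd x (hA hxA))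
        · intro c _ g hg
          rw [Finset.mem_filter, Finset.insert_erase hxA] at hg
          refine Finset.mem_erase.2 ⟨?_, Finset.mem_filter.2 ⟨hg.1, hg.2.1⟩⟩
          rintro rfl
          exact hesub hg.2.2.1
        · intro c _ d _ g h1 h2
          rw [Finset.mem_filter] at h1 h2
          exact monoEdges_color_unique (φ := φ) (x := x)
            (Finset.mem_filter.2 ⟨h1.1, h1.2.1, h1.2.2.2⟩)
            (Finset.mem_filter.2 ⟨h2.1, h2.2.1, h2.2.2.2⟩)
      obtain ⟨c, _, hc⟩ := Finset.exists_lt_of_sum_lt hlt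
      refine ⟨Function.update φ x c, ?_⟩
      have := hφ.insert (Finset.notMem_erase x A) hc
      rwa [Finset.insert_erase hxA] at this

/-- Otherwise `x` could receive color `c`, completing a good coloring. -/
theorem Critical.le_card_monoEdges (hcr : H.Critical f P) (h : H.GoodOff f x φ) (c : C) :
    f x c ≤ (H.monoEdges φ x c).card := by
  by_contra! hlt
  refine hcr.not_good (Function.update φ x c) ?_
  have := h.2.insert (c := c) (Finset.notMem_erase x _) (lt_of_le_of_lt (Finset.card_le_card ?_) hlt)
  · rwa [Finset.insert_erase h.1] at this
  · intro e he
    rw [Finset.mem_filter] at he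
    exact Finset.mem_filter.2 ⟨he.1, he.2.1, he.2.2.2⟩

theorem Critical.degree_eq (hcr : H.Critical f P) (h : H.GoodOff f x φ) :
    H.degree x = ∑ c ∈ P, f x c :=
  le_antisymm (hcr.degree_le x h.1) ((Finset.sum_le_sum fun c _ => hcr.le_card_monoEdges h c).trans
    (sum_monoEdges_le x))

theorem Critical.sum_monoEdges_eq (hcr : H.Critical f P) (h : H.GoodOff f x φ) :
    ∑ c ∈ P, (H.monoEdges φ x c).card = H.degree x :=
  le_antisymm (sum_monoEdges_le x) ((hcr.degree_eq h).trans_le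
    (Finset.sum_le_sum fun c _ => hcr.le_card_monoEdges h c))

/-- Every edge at the uncolored vertex is monochromatic apart from that vertex. -/
theorem Critical.exists_color (hcr : H.Critical f P) (h : H.GoodOff f x φ) {e : β}
    (he : e ∈ H.edges) (hxe : x ∈ H.inc e) : ∃ c ∈ P, e ∈ H.monoEdges φ x c := by
  by_contra! hno
  have hlt : ∑ c ∈ P, (H.monoEdges φ x c).card < H.degree x := by
    refine lt_of_le_of_lt (sum_card_le_card P _ ((H.edges.filter (fun e => x ∈ H.inc e)).erase e)
      ?_ (fun c _ d _ e h1 h2 => monoEdges_color_unique h1 h2))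
      (Finset.card_erase_lt_of_mem (Finset.mem_filter.2 ⟨he, hxe⟩))
    intro c hc g hg
    refine Finset.mem_erase.2 ⟨fun hge => hno c hc (hge ▸ hg), ?_⟩
    rw [monoEdges, Finset.mem_filter] at hg
    exact Finset.mem_filter.2 ⟨hg.1, hg.2.1⟩
  exact hlt.ne (hcr.sum_monoEdges_eq h)

/-- The termwise bounds `le_card_monoEdges` have equal sums over `P`, so each is an equality.
Outside `P` both sides vanish, because every edge at `x` has its color in `P`. -/
theorem Critical.card_monoEdges (hcr : H.Critical f P) (h : H.GoodOff f x φ) (c : C) :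
    (H.monoEdges φ x c).card = f x c := by
  by_cases hc : c ∈ P
  · have := (Finset.sum_eq_sum_iff_of_le (s := P)
      fun c _ => hcr.le_card_monoEdges h c).1
      ((hcr.degree_eq h).symm.trans (hcr.sum_monoEdges_eq h).symm)
    exact (this c hc).symm
  · rw [hcr.eq_zero x h.1 c hc, Finset.card_eq_zero, Finset.eq_empty_iff_forall_notMem]
    intro e he
    have he' := Finset.mem_filter.1 he
    obtain ⟨d, hd, hed⟩ := hcr.exists_color h he'.1 he'.2.1
    exact hc (monoEdges_color_unique he hed ▸ hd)

theorem Critical.eq_color (hcr : H.Critical f P) (h : H.GoodOff f x φ) {e : β}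
    (he : e ∈ H.edges) (hxe : x ∈ H.inc e) (hy : y ∈ H.inc e) (hyx : y ≠ x)
    (hz : z ∈ H.inc e) (hzx : z ≠ x) : φ y = φ z := by
  obtain ⟨c, _, hc⟩ := hcr.exists_color h he hxe
  have := (Finset.mem_filter.1 hc).2.2
  rw [this y hy hyx, this z hz hzx]

theorem Critical.pos_of_adj (hcr : H.Critical f P) (h : H.GoodOff f x φ) (hxy : H.Adj x y) :
    0 < f x (φ y) := by
  obtain ⟨hne, e, he, hx, hy⟩ := hxy
  obtain ⟨c, _, hc⟩ := hcr.exists_color h he hx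
  rw [(Finset.mem_filter.1 hc).2.2 y hy hne.symm, ← hcr.card_monoEdges h]
  exact Finset.card_pos.2 ⟨e, hc⟩

theorem Critical.exists_adj (hcr : H.Critical f P) (h : H.GoodOff f x φ) {c : C}
    (hc : 0 < f x c) : ∃ w, H.Adj x w ∧ φ w = c := by
  rw [← hcr.card_monoEdges h] at hc
  obtain ⟨e, he⟩ := Finset.card_pos.1 hc
  have he' := Finset.mem_filter.1 he
  obtain ⟨w, hw, hwx⟩ := exists_other he'.1 x
  exact ⟨w, ⟨hwx.symm, e, he'.1, he'.2.1, hw⟩, he'.2.2 w hw hwx⟩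

/-- The uncolored vertex can be moved to any adjacent vertex. -/
theorem Critical.shift (hcr : H.Critical f P) (h : H.GoodOff f x φ) (hxy : H.Adj x y) :
    H.GoodOff f y (Function.update φ x (φ y)) := by
  refine ⟨hxy.mem_right, ?_⟩
  intro X hX hne c hc
  have hyX : y ∉ X := fun hy => (Finset.mem_erase.1 (hX hy)).1 rfl
  by_cases hxX : x ∈ X
  · refine ⟨x, hxX, ?_⟩
    have hcc : φ y = c := by simpa using hc x hxX
    obtain ⟨hne', e, he, hxe, hye⟩ := hxy
    obtain ⟨d, _, hd⟩ := hcr.exists_color h he hxe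
    have hdc : d = c := ((Finset.mem_filter.1 hd).2.2 y hye hne'.symm).symm.trans hcc
    subst hdc
    rw [← hcr.card_monoEdges h]
    -- The `f x d` edges of color `d` at `x` include `e`, which now contains the uncolored `y`;
    -- losing it gives the strict inequality.
    refine lt_of_le_of_lt (Finset.card_le_card (t := (H.monoEdges φ x d).erase e) ?_)
      (Finset.card_erase_lt_of_mem hd)
    intro g hg
    rw [Finset.mem_filter] at hg
    refine Finset.mem_erase.2 ⟨?_, Finset.mem_filter.2 ⟨hg.1, hg.2.1, fun u hu hux => ?_⟩⟩
    · rintro rfl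
      exact hyX (hg.2.2 hye)
    · have := hc u (hg.2.2 hu)
      rwa [Function.update_of_ne hux] at this
  · refine h.2 X (fun u hu => Finset.mem_erase.2 ⟨?_, (Finset.mem_erase.1 (hX hu)).2⟩) hne c
      fun u hu => ?_
    · rintro rfl
      exact hxX hu
    · have := hc u hu
      rwa [Function.update_of_ne (by rintro rfl; exact hxX hu)] at this

/-- The uncolored vertex can be moved along any walk, and the colors change only at the vertices
that are left by the walk. -/
theorem Critical.walk (hcr : H.Critical f P) (h : H.GoodOff f x φ) {W : Set α}
    (hW : H.Reach W x y) : ∃ ψ : α → C, H.GoodOff f y ψ ∧ ∀ u, u ∉ W → ψ u = φ u := by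
  induction hW with
  | refl => exact ⟨φ, h, fun _ _ => rfl⟩
  | tail _ hstep ih =>
    obtain ⟨ψ, hψ, heq⟩ := ih
    refine ⟨_, hcr.shift hψ hstep.2, fun u hu => ?_⟩
    rw [Function.update_of_ne (by rintro rfl; exact hu hstep.1), heq u hu]

theorem Reach.mono {W W' : Set α} (h : H.Reach W x y) (hW : W ⊆ W') : H.Reach W' x y := by
  induction h with
  | refl => exact Relation.ReflTransGen.refl
  | tail _ hs ih => exact Relation.ReflTransGen.tail ih ⟨hW hs.1, hs.2⟩

/-- A walk into `T` can be stopped as soon as it meets `T`. -/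
theorem Reach.first_hit {W T : Set α} (h : H.Reach W x y) (hy : y ∈ T) :
    ∃ t ∈ T, H.Reach (W \ T) x t := by
  induction h using Relation.ReflTransGen.head_induction_on with
  | refl => exact ⟨y, hy, Relation.ReflTransGen.refl⟩
  | @head u v hstep _ ih =>
    by_cases ha : u ∈ T
    · exact ⟨u, ha, Relation.ReflTransGen.refl⟩
    · obtain ⟨t, ht, hr⟩ := ih
      exact ⟨t, ht, Relation.ReflTransGen.head ⟨⟨hstep.1, ha⟩, hstep.2⟩ hr⟩

/-- A walk that ends outside `W` but starts in it has a last step. -/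
theorem Reach.last_step {W : Set α} (h : H.Reach W x y) (hx : x ∈ W) (hy : y ∉ W) :
    ∃ w ∈ W, H.Reach W x w ∧ H.Adj w y := by
  rcases Relation.ReflTransGen.cases_tail h with rfl | ⟨w, hw, hs⟩
  · exact absurd hx hy
  · exact ⟨w, hs.1, hw, hs.2⟩

/-- No vertex separates `H`: all pairs of vertices other than `x` are joined by a walk
avoiding `x`. -/
def NonSeparable (H : MultiHypergraph α β) : Prop :=
  ∀ x ∈ H.verts, ∀ y ∈ H.verts, ∀ z ∈ H.verts, y ≠ x → z ≠ x → H.Reach {x}ᶜ y z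

/-- Slide the hole from `x` to a neighbor of color `b`, so that `x` gets `b`, and then to `y` while
avoiding `x`. Now `y` is uncolored and sees color `b` at `x`. -/
theorem Critical.pos_of_pos (hcr : H.Critical f P) (hns : H.NonSeparable)
    (h : H.GoodOff f x φ) (hxy : H.Adj x y) {b : C} (hb : 0 < f x b) : 0 < f y b := by
  obtain ⟨w, hw, hwb⟩ := hcr.exists_adj h hb
  obtain ⟨ψ, hψ, heq⟩ := hcr.walk (hcr.shift h hw)
    (hns x hxy.mem_left w hw.mem_right y hxy.mem_right hw.1.symm hxy.1.symm)
  have := hcr.pos_of_adj hψ hxy.symm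
  rwa [heq x (by simp), Function.update_self, hwb] at this

/-- With the hole at `y` in `e`, the rest of `e` has one color. Slide the hole away so that `y` gets
a different color, and bring it back, avoiding `y`, until it first meets `e` at `t`. A third vertex
`z` of `e` has kept its color, so `y` and `z` contradict the monochromaticity of `e` apart from `t`.
-/
theorem Critical.card_inc (hcr : H.Critical f P) (hns : H.NonSeparable)
    (hst : ∀ x ∈ H.verts, ∃ φ : α → C, H.GoodOff f x φ)
    (hf : ∀ x ∈ H.verts, ∀ a, ∃ b, b ≠ a ∧ 0 < f x b) {e : β} (he : e ∈ H.edges) :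
    (H.inc e).card = 2 := by
  by_contra hcard
  have h3 : 2 < (H.inc e).card := lt_of_le_of_ne (H.two_le_card_inc e he) (Ne.symm hcard)
  obtain ⟨y, hy⟩ : (H.inc e).Nonempty := Finset.card_pos.1 (by omega)
  have hyv := H.inc_subset e he hy
  obtain ⟨φ, hφ⟩ := hst y hyv
  obtain ⟨x, hx, hxy⟩ := exists_other he y
  obtain ⟨b, hba, hb⟩ := hf y hyv (φ x)
  obtain ⟨w, hw, hwb⟩ := hcr.exists_adj hφ hb
  obtain ⟨t, ht, hr⟩ := (hns y hyv w hw.mem_right x (H.inc_subset e he hx) hw.1.symm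
    hxy).first_hit (T := {u | u ∈ H.inc e ∧ u ≠ y}) ⟨hx, hxy⟩
  obtain ⟨ψ, hψ, heq⟩ := hcr.walk (hcr.shift hφ hw) hr
  obtain ⟨z, hz⟩ : (((H.inc e).erase y).erase t).Nonempty := by
    refine Finset.card_pos.1 ?_
    rw [Finset.card_erase_of_mem (Finset.mem_erase.2 ⟨ht.2, ht.1⟩), Finset.card_erase_of_mem hy]
    omega
  simp only [Finset.mem_erase] at hz
  have h1 := hcr.eq_color hψ he ht.1 hy ht.2.symm hz.2.2 hz.1
  rw [heq y (by simp), heq z (by simp [hz.2.1, hz.2.2]), Function.update_self,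
    Function.update_of_ne hz.2.1, hwb, hcr.eq_color hφ he hy hz.2.2 hz.2.1 hx hxy] at h1
  exact hba h1

end Transport

end MultiHypergraph

namespace MultiHypergraph

/-! ### Critical blocks: neighborhoods and the components beyond them -/

section Blocks

open Classical

variable {α β C : Type*}

/-- A critical hypergraph without separating vertices in which at least two colors are available at
every vertex. -/
structure CriticalBlock (H : MultiHypergraph α β) (f : α → C → ℕ) (P : Finset C) : Prop where
  critical : H.Critical f P
  nonSeparable : H.NonSeparable
  exists_goodOff : ∀ x ∈ H.verts, ∃ φ : α → C, H.GoodOff f x φ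
  exists_color_ne : ∀ x ∈ H.verts, ∀ a, ∃ b, b ≠ a ∧ 0 < f x b

/-- `W` is the vertex set of a component of the hypergraph that remains when `x` and all vertices
adjacent to `x` are deleted. -/
structure IsFarComponent (H : MultiHypergraph α β) (x : α) (W : Set α) : Prop where
  nonempty : W.Nonempty
  subset : ∀ w ∈ W, w ∈ H.verts
  ne : ∀ w ∈ W, w ≠ x
  not_adj : ∀ w ∈ W, ¬ H.Adj x w
  reach : ∀ w ∈ W, ∀ w' ∈ W, H.Reach W w w'
  closed : ∀ w ∈ W, ∀ t, H.Adj w t → t ∈ W ∨ H.Adj x t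

variable {H : MultiHypergraph α β} {f : α → C → ℕ} {P : Finset C} {φ ψ : α → C} {x y z u v w : α}
  {W : Set α}

theorem edgeMultiplicity_comm (H : MultiHypergraph α β) (u v : α) :
    H.edgeMultiplicity u v = H.edgeMultiplicity v u := by
  unfold edgeMultiplicity
  rw [Set.pair_comm]

theorem exists_inc_eq_pair (h2 : ∀ e ∈ H.edges, (H.inc e).card = 2) {e : β} (he : e ∈ H.edges)
    (hx : x ∈ H.inc e) : ∃ u, u ≠ x ∧ u ∈ H.verts ∧ (H.inc e : Set α) = {x, u} := by
  obtain ⟨u, hu, hux⟩ := exists_other he x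
  refine ⟨u, hux, H.inc_subset e he hu, ?_⟩
  have : ({x, u} : Finset α) = H.inc e := by
    refine Finset.eq_of_subset_of_card_le ?_ ?_
    · intro t ht
      rcases Finset.mem_insert.1 ht with rfl | ht
      · exact hx
      · rwa [Finset.mem_singleton.1 ht]
    · rw [h2 e he, Finset.card_pair hux.symm]
  rw [← this]
  simp

theorem card_monoEdges_eq_sum (h2 : ∀ e ∈ H.edges, (H.inc e).card = 2) (φ : α → C) (x : α)
    (c : C) : (H.monoEdges φ x c).card =
      ∑ u ∈ H.verts.erase x, if φ u = c then H.edgeMultiplicity x u else 0 := by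
  rw [← Finset.sum_filter]
  unfold edgeMultiplicity
  rw [← Finset.card_biUnion]
  · congr 1
    ext e
    simp only [monoEdges, Finset.mem_filter, Finset.mem_biUnion, Finset.mem_erase]
    constructor
    · rintro ⟨he, hx, hm⟩
      obtain ⟨u, hux, huv, hinc⟩ := exists_inc_eq_pair h2 he hx
      have hu : u ∈ H.inc e := by rw [← Finset.mem_coe, hinc]; simp
      exact ⟨u, ⟨⟨hux, huv⟩, hm u hu hux⟩, he, hinc⟩
    · rintro ⟨u, ⟨⟨hux, huv⟩, hc⟩, he, hinc⟩
      refine ⟨he, by rw [← Finset.mem_coe, hinc]; simp, fun t ht htx => ?_⟩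
      rw [← Finset.mem_coe, hinc] at ht
      rcases ht with rfl | rfl
      · exact absurd rfl htx
      · exact hc
  · intro u hu v _ huv
    refine Finset.disjoint_left.2 fun e h1 h3 => huv ?_
    have hux : u ≠ x := (Finset.mem_erase.1 (Finset.mem_filter.1 hu).1).1
    have : u ∈ ({x, v} : Set α) := by
      rw [← (Finset.mem_filter.1 h3).2, (Finset.mem_filter.1 h1).2]; simp
    rcases this with h | h
    · exact absurd h hux
    · exact h

theorem degree_eq_sum (h2 : ∀ e ∈ H.edges, (H.inc e).card = 2) (x : α) :
    H.degree x = ∑ u ∈ H.verts.erase x, H.edgeMultiplicity x u := by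
  have := card_monoEdges_eq_sum h2 (fun _ => ()) x ()
  simpa [monoEdges, degree] using this

theorem edgeMultiplicity_pos (h2 : ∀ e ∈ H.edges, (H.inc e).card = 2) (h : H.Adj x y) :
    0 < H.edgeMultiplicity x y := by
  obtain ⟨hne, e, he, hx, hy⟩ := h
  obtain ⟨u, hux, _, hinc⟩ := exists_inc_eq_pair h2 he hx
  refine Finset.card_pos.2 ⟨e, Finset.mem_filter.2 ⟨he, ?_⟩⟩
  rw [← Finset.mem_coe, hinc] at hy
  rcases hy with rfl | rfl
  · exact absurd rfl hne
  · exact hinc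

theorem edgeMultiplicity_eq_zero (hne : x ≠ y) (h : ¬ H.Adj x y) : H.edgeMultiplicity x y = 0 := by
  refine Finset.card_eq_zero.2 (Finset.filter_eq_empty_iff.2 fun e he hinc => h ⟨hne, e, he, ?_⟩)
  constructor <;> rw [← Finset.mem_coe, hinc] <;> simp

theorem CriticalBlock.card_inc_eq_two (hb : H.CriticalBlock f P) :
    ∀ e ∈ H.edges, (H.inc e).card = 2 :=
  fun _ he => hb.critical.card_inc hb.nonSeparable hb.exists_goodOff hb.exists_color_ne he

/-- Two good colorings with the same uncolored vertex `x` that differ, among the neighbors of `x`,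
only at `y` and `z`. -/
theorem CriticalBlock.exchange (hb : H.CriticalBlock f P) (hφ : H.GoodOff f x φ)
    (hψ : H.GoodOff f x ψ) (hy : H.Adj x y) (hz : H.Adj x z) (hyz : y ≠ z)
    (heq : ∀ t, H.Adj x t → t ≠ y → t ≠ z → ψ t = φ t) (hzy : ψ z = φ y) :
    ψ y = φ z ∧ (φ y ≠ φ z → H.edgeMultiplicity x y = H.edgeMultiplicity x z) := by
  have h2 := hb.card_inc_eq_two
  -- Both colorings give exactly `f x c` edges of color `c` at `x`; the contributions of all
  -- neighbors other than `y` and `z` cancel.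
  have key : ∀ c, (if ψ y = c then H.edgeMultiplicity x y else 0) +
      (if ψ z = c then H.edgeMultiplicity x z else 0) =
      (if φ y = c then H.edgeMultiplicity x y else 0) +
      (if φ z = c then H.edgeMultiplicity x z else 0) := by
    intro c
    have hsum := (hb.critical.card_monoEdges hφ c).trans (hb.critical.card_monoEdges hψ c).symm
    rw [card_monoEdges_eq_sum h2, card_monoEdges_eq_sum h2] at hsum
    have hyv : y ∈ H.verts.erase x := Finset.mem_erase.2 ⟨hy.1.symm, hy.mem_right⟩
    have hzv : z ∈ (H.verts.erase x).erase y :=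
      Finset.mem_erase.2 ⟨hyz.symm, Finset.mem_erase.2 ⟨hz.1.symm, hz.mem_right⟩⟩
    rw [← Finset.add_sum_erase _ _ hyv, ← Finset.add_sum_erase _ _ hzv,
      ← Finset.add_sum_erase _ _ hyv, ← Finset.add_sum_erase _ _ hzv] at hsum
    have hrest : ∑ t ∈ ((H.verts.erase x).erase y).erase z,
        (if φ t = c then H.edgeMultiplicity x t else 0) =
        ∑ t ∈ ((H.verts.erase x).erase y).erase z,
        (if ψ t = c then H.edgeMultiplicity x t else 0) := by
      refine Finset.sum_congr rfl fun t ht => ?_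
      simp only [Finset.mem_erase] at ht
      by_cases hadj : H.Adj x t
      · rw [heq t hadj ht.2.1 ht.1]
      · rw [edgeMultiplicity_eq_zero ht.2.2.1.symm hadj]
        simp
    omega
  have hpy := edgeMultiplicity_pos h2 hy
  have hpz := edgeMultiplicity_pos h2 hz
  have hk := key (φ z)
  rw [hzy] at hk
  by_cases hc : φ y = φ z
  · refine ⟨?_, fun h => absurd hc h⟩
    by_contra hne
    simp only [hne, hc, if_true, if_false] at hk
    omega
  · by_cases hne : ψ y = φ z
    · simp only [hne, hc, if_true, if_false] at hk
      exact ⟨hne, fun _ => by omega⟩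
    · simp only [hne, hc, if_true, if_false] at hk
      omega

/-- `Reach` restricts only the vertices that a walk leaves, so the last clause has to ask separately
that the endpoint `w` is neither `x` nor adjacent to it. -/
theorem exists_isFarComponent (hu : u ∈ H.verts) (hux : u ≠ x) (hadj : ¬ H.Adj x u) :
    ∃ W, H.IsFarComponent x W ∧ u ∈ W ∧
      ∀ w, H.Reach {t | t ≠ x ∧ ¬ H.Adj x t} u w → w ≠ x → ¬ H.Adj x w → w ∈ W := by
  set F : Set α := {t | t ≠ x ∧ ¬ H.Adj x t} with hF
  let W : Set α := {w | w ∈ F ∧ H.Reach F u w}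
  have huW : u ∈ W := ⟨⟨hux, hadj⟩, Relation.ReflTransGen.refl⟩
  have hfrom : ∀ w, H.Reach F u w → H.Reach W u w := by
    intro w hw
    induction hw with
    | refl => exact Relation.ReflTransGen.refl
    | tail h1 h2 ih => exact Relation.ReflTransGen.tail ih ⟨⟨h2.1, h1⟩, h2.2⟩
  have hto : ∀ w, H.Reach W u w → w ∈ W → H.Reach W w u := by
    intro w hw
    induction hw with
    | refl => exact fun _ => Relation.ReflTransGen.refl
    | tail h1 h2 ih =>
      exact fun hc => Relation.ReflTransGen.head ⟨hc, h2.2.symm⟩ (ih h2.1)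
  refine ⟨W, ⟨⟨u, huW⟩, ?_, fun w hw => hw.1.1, fun w hw => hw.1.2, ?_, ?_⟩, huW,
    fun w hw h1 h2 => ⟨⟨h1, h2⟩, hw⟩⟩
  · intro w hw
    rcases Relation.ReflTransGen.cases_tail hw.2 with rfl | ⟨t, _, ht⟩
    · exact hu
    · exact ht.2.mem_right
  · intro w hw w' hw'
    exact (hto w (hfrom w hw.2) hw).trans (hfrom w' hw'.2)
  · intro w hw t ht
    by_cases h : H.Adj x t
    · exact Or.inr h
    · refine Or.inl ⟨⟨?_, h⟩, Relation.ReflTransGen.tail hw.2 ⟨hw.1, ht⟩⟩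
      rintro rfl
      exact hw.1.2 ht.symm

theorem IsFarComponent.notMem_of_adj (hW : H.IsFarComponent x W) (h : H.Adj x y) : y ∉ W :=
  fun hy => hW.not_adj y hy h

theorem IsFarComponent.self_notMem (hW : H.IsFarComponent x W) : x ∉ W :=
  fun hx => hW.ne x hx rfl

theorem IsFarComponent.adj_of_notMem (hW : H.IsFarComponent x W) (hw : w ∈ W) (h : H.Adj w y)
    (hy : y ∉ W) : H.Adj x y :=
  (hW.closed w hw y h).resolve_left hy

/-- Moving the uncolored vertex `x` around a closed walk `x, y, u, …, w, z, x` through `W`. -/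
theorem CriticalBlock.rotate (hb : H.CriticalBlock f P) (hφ : H.GoodOff f x φ)
    (hW : H.IsFarComponent x W) (hy : H.Adj x y) (hz : H.Adj x z) (hyz : y ≠ z)
    (hu : u ∈ W) (huy : H.Adj u y) (hw : w ∈ W) (hwz : H.Adj w z) :
    ∃ ψ : α → C, H.GoodOff f x ψ ∧ ψ y = φ u ∧ ψ z = φ y ∧
      ∀ t, t ∉ W → t ≠ x → t ≠ y → t ≠ z → ψ t = φ t := by
  have hr : H.Reach W u z := Relation.ReflTransGen.tail (hW.reach u hu w hw) ⟨hw, hwz⟩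
  obtain ⟨χ, hχ, heq⟩ := hb.critical.walk (hb.critical.shift (hb.critical.shift hφ hy) huy.symm) hr
  refine ⟨_, hb.critical.shift hχ hz.symm, ?_, ?_, fun t htW htx hty htz => ?_⟩
  · rw [Function.update_of_ne hyz, heq y (hW.notMem_of_adj hy), Function.update_self,
      Function.update_of_ne (hW.ne u hu)]
  · rw [Function.update_self, heq x hW.self_notMem, Function.update_of_ne hy.1,
      Function.update_self]
  · rw [Function.update_of_ne htz, heq t htW, Function.update_of_ne hty, Function.update_of_ne htx]

/-- The closed walk of `rotate` moves the color of `u` to `y` and that of `y` to `z`. Since the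
color counts at `x` are fixed, `y` must have received the old color of `z`. -/
theorem CriticalBlock.color_eq (hb : H.CriticalBlock f P) (hφ : H.GoodOff f x φ)
    (hW : H.IsFarComponent x W) (hy : H.Adj x y) (hz : H.Adj x z) (hyz : y ≠ z)
    (hu : u ∈ W) (huy : H.Adj u y) (hw : w ∈ W) (hwz : H.Adj w z) :
    φ u = φ z ∧ (φ y ≠ φ z → H.edgeMultiplicity x y = H.edgeMultiplicity x z) := by
  obtain ⟨ψ, hψ, h1, h2, h3⟩ := hb.rotate hφ hW hy hz hyz hu huy hw hwz
  have := hb.exchange hφ hψ hy hz hyz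
    (fun t ht => h3 t (hW.notMem_of_adj ht) ht.1.symm) h2
  rwa [h1] at this

/-- Since `y` is not a cut vertex, a walk from `W` to `x` avoids it; the first vertex of this walk
outside `W` is the required `z`. -/
theorem CriticalBlock.exists_attachment_ne (hb : H.CriticalBlock f P) (hx : x ∈ H.verts)
    (hW : H.IsFarComponent x W) (hy : H.Adj x y) :
    ∃ z, z ≠ y ∧ H.Adj x z ∧ ∃ w ∈ W, H.Adj w z := by
  obtain ⟨w, hw⟩ := hW.nonempty
  have hyW := hW.notMem_of_adj hy
  obtain ⟨z, hz, hr⟩ := (hb.nonSeparable y hy.mem_right w (hW.subset w hw) x hx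
    (by rintro rfl; exact hyW hw) hy.1).first_hit (T := {t | t ∉ W ∧ t ≠ y})
    ⟨hW.self_notMem, hy.1⟩
  have hr' : H.Reach W w z := hr.mono fun t ht => by
    by_contra htW
    exact ht.2 ⟨htW, ht.1⟩
  obtain ⟨w', hw', _, hadj⟩ := hr'.last_step hw hz.1
  exact ⟨z, hz.2, hW.adj_of_notMem hw' hadj hz.1, w', hw', hadj⟩

theorem CriticalBlock.exists_attachment (hb : H.CriticalBlock f P) (hx : x ∈ H.verts)
    (hW : H.IsFarComponent x W) : ∃ y, H.Adj x y ∧ ∃ w ∈ W, H.Adj w y := by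
  obtain ⟨φ, hφ⟩ := hb.exists_goodOff x hx
  obtain ⟨w, hw⟩ := hW.nonempty
  obtain ⟨b, -, hbp⟩ := hb.exists_color_ne x hx (φ x)
  obtain ⟨y, hy, -⟩ := hb.critical.exists_adj hφ hbp
  obtain ⟨z, -, hz⟩ := hb.exists_attachment_ne hx hW hy
  exact ⟨z, hz⟩

/-- If all attachments had color `a`, then so would `u`, by `color_eq`. Sending the hole through `W`
gives `u` another color `b` and, on return to `x`, leaves every attachment with color `a`. Applying
`color_eq` again contradicts this. -/
theorem CriticalBlock.attachments_not_monochromatic (hb : H.CriticalBlock f P)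
    (hφ : H.GoodOff f x φ) (hW : H.IsFarComponent x W) (a : C)
    (ha : ∀ t, H.Adj x t → (∃ w ∈ W, H.Adj w t) → φ t = a) : False := by
  obtain ⟨y, hy, u, hu, huy⟩ := hb.exists_attachment hφ.1 hW
  obtain ⟨z, hzy, hz, w, hw, hwz⟩ := hb.exists_attachment_ne hφ.1 hW hy
  have hua : φ u = a := (hb.color_eq hφ hW hy hz hzy.symm hu huy hw hwz).1.trans
    (ha z hz ⟨w, hw, hwz⟩)
  have hya : φ y = a := ha y hy ⟨u, hu, huy⟩
  have hux := hW.ne u hu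
  have hs := hb.critical.shift (hb.critical.shift hφ hy) huy.symm
  -- After the hole moves from `x` via `y` to `u`, only `x` has a new color, because `y` and `u`
  -- both had color `a`.
  set φ₂ := Function.update (Function.update φ x (φ y)) y (Function.update φ x (φ y) u) with hφ₂
  have h2x : φ₂ x = a := by
    rw [hφ₂, Function.update_of_ne hy.1, Function.update_self, hya]
  have h2 : ∀ t, t ≠ x → φ₂ t = φ t := by
    intro t ht
    by_cases hty : t = y
    · rw [hty, hφ₂, Function.update_self, Function.update_of_ne hux, hua, hya]
    · rw [hφ₂, Function.update_of_ne hty, Function.update_of_ne ht]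
  obtain ⟨b, hba, hbp⟩ := hb.exists_color_ne u hs.1 a
  obtain ⟨p, hp, hpb⟩ := hb.critical.exists_adj hs hbp
  have hpx : p ≠ x := by
    rintro rfl
    exact hba (hpb.symm.trans h2x)
  have hpW : p ∈ W := by
    by_contra hpW
    refine hba (hpb.symm.trans ((h2 p hpx).trans (ha p (hW.adj_of_notMem hu hp hpW) ⟨u, hu, hp⟩)))
  -- The hole goes from `p` out of `W` without using `u`, so `u` keeps color `b`; the exit `t` is a
  -- neighbor of `x` and finally takes color `a` from `x`.
  obtain ⟨t, ht, hr⟩ := (hb.nonSeparable u hs.1 p hp.mem_right x hφ.1 hp.1.symm hux.symm).first_hit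
    (T := Wᶜ) hW.self_notMem
  have hr' : H.Reach W p t := hr.mono fun s hs => by simpa using hs.2
  obtain ⟨q, hq, _, hqt⟩ := hr'.last_step hpW ht
  have hxt := hW.adj_of_notMem hq hqt ht
  obtain ⟨χ, hχ, heq⟩ := hb.critical.walk (hb.critical.shift hs hp) hr
  have hχ' := hb.critical.shift hχ hxt.symm
  have hχx : χ x = a := by
    rw [heq x (fun h => h.2 hW.self_notMem), Function.update_of_ne hux.symm, h2x]
  have hz' : ∀ s, H.Adj x s → (∃ w ∈ W, H.Adj w s) → Function.update χ t (χ x) s = a := by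
    intro s hs1 hs2
    by_cases hst : s = t
    · rw [hst, Function.update_self, hχx]
    · have hsW := hW.notMem_of_adj hs1
      rw [Function.update_of_ne hst, heq s (fun h => h.2 hsW), Function.update_of_ne
        (by rintro rfl; exact hsW hu), h2 s hs1.1.symm, ha s hs1 hs2]
  have hfin := (hb.color_eq hχ' hW hy hz hzy.symm hu huy hw hwz).1
  rw [hz' z hz ⟨w, hw, hwz⟩, Function.update_of_ne (by rintro rfl; exact ht hu),
    heq u (fun h => h.1 rfl), Function.update_self, hpb] at hfin
  exact hba hfin

/-- A component of `H - N[x]` is attached to exactly two neighbors of `x`. -/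
theorem CriticalBlock.exists_attachment_pair (hb : H.CriticalBlock f P) (hx : x ∈ H.verts)
    (hW : H.IsFarComponent x W) :
    ∃ y z, y ≠ z ∧ H.Adj x y ∧ H.Adj x z ∧ (∃ w ∈ W, H.Adj w y) ∧ (∃ w ∈ W, H.Adj w z) ∧
      ∀ t, H.Adj x t → (∃ w ∈ W, H.Adj w t) → t = y ∨ t = z := by
  obtain ⟨y, hy, hyW⟩ := hb.exists_attachment hx hW
  obtain ⟨z, hzy, hz, hzW⟩ := hb.exists_attachment_ne hx hW hy
  refine ⟨y, z, hzy.symm, hy, hz, hyW, hzW, ?_⟩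
  by_contra! ⟨v, hv, hvW, hvy, hvz⟩
  obtain ⟨φ, hφ⟩ := hb.exists_goodOff x hx
  -- By `color_eq`, a neighbor in `W` of the attachment `t` has the color of each other attachment;
  -- so three attachments would all have the same color.
  have key : ∀ r s t, H.Adj x r → (∃ w ∈ W, H.Adj w r) → H.Adj x s → (∃ w ∈ W, H.Adj w s) →
      H.Adj x t → (∃ w ∈ W, H.Adj w t) → t ≠ r → t ≠ s → φ r = φ s := by
    rintro r s t hr ⟨_, hrW, hrW'⟩ hs ⟨_, hsW, hsW'⟩ ht ⟨_, htW, htW'⟩ htr hts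
    rw [← (hb.color_eq hφ hW ht hr htr htW htW' hrW hrW').1,
      ← (hb.color_eq hφ hW ht hs hts htW htW' hsW hsW').1]
  refine hb.attachments_not_monochromatic hφ hW (φ y) fun t ht htW => ?_
  by_cases htz : z = t
  · subst htz
    exact key z y v ht htW hy hyW hv hvW hvz hvy
  · exact key t y z ht htW hy hyW hz hzW htz hzy

theorem CriticalBlock.attachment_pair_ne (hb : H.CriticalBlock f P)
    (hφ : H.GoodOff f x φ) (hW : H.IsFarComponent x W)
    (hB : ∀ t, H.Adj x t → (∃ w ∈ W, H.Adj w t) → t = y ∨ t = z) : φ y ≠ φ z := by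
  intro h
  refine hb.attachments_not_monochromatic hφ hW (φ z) fun t ht htW => ?_
  rcases hB t ht htW with rfl | rfl
  · exact h
  · rfl

/-- Take `u` in `W` next to `y`, and let `p` be the last vertex before `y` on the walk. Seen from
`u`, both `x` and `p` lie in one far component and are adjacent to `y`. With the hole moved to `u`,
`color_eq` makes their colors equal, so `p` has the color of `y` in every good coloring off `x`. But
rotating through `W` changes the color of `y` and not that of `p`. -/
theorem CriticalBlock.false_of_reach (hb : H.CriticalBlock f P) (hx : x ∈ H.verts)
    (hW : H.IsFarComponent x W) (hyz : y ≠ z) (hy : H.Adj x y) (hz : H.Adj x z)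
    (hyW : ∃ w ∈ W, H.Adj w y) (hzW : ∃ w ∈ W, H.Adj w z)
    (hB : ∀ t, H.Adj x t → (∃ w ∈ W, H.Adj w t) → t = y ∨ t = z)
    (hv : H.Adj x v) (hvy : v ≠ y) (hvz : v ≠ z)
    (hr : H.Reach {t | t ≠ x ∧ t ≠ y ∧ t ≠ z} v y) : False := by
  obtain ⟨p, hp, hvp, hpy⟩ := hr.last_step ⟨hv.1.symm, hvy, hvz⟩ (by simp)
  obtain ⟨u, hu, huy⟩ := hyW
  obtain ⟨w, hw, hwz⟩ := hzW
  have hstep : ∀ t s, t ∉ W → t ≠ y → t ≠ z → s ∈ W → ¬ H.Adj s t := by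
    intro t s ht hty htz hs hst
    rcases hB t (hW.adj_of_notMem hs hst ht) ⟨s, hs, hst⟩ with h | h
    · exact hty h
    · exact htz h
  have hnotW : ∀ t, H.Reach {t | t ≠ x ∧ t ≠ y ∧ t ≠ z} v t → t ∉ W := by
    intro t ht
    induction ht with
    | refl => exact hW.notMem_of_adj hv
    | tail _ h2 ih => exact fun hc => hstep _ _ ih h2.1.2.1 h2.1.2.2 hc h2.2.symm
  have hfar : ∀ t, H.Reach {t | t ≠ x ∧ t ≠ y ∧ t ≠ z} v t →
      H.Reach {t | t ≠ u ∧ ¬ H.Adj u t} v t := by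
    intro t ht
    induction ht with
    | refl => exact Relation.ReflTransGen.refl
    | tail h1 h2 ih =>
      refine Relation.ReflTransGen.tail ih ⟨⟨?_, hstep _ _ (hnotW _ h1) h2.1.2.1 h2.1.2.2 hu⟩, h2.2⟩
      rintro rfl
      exact hnotW _ h1 hu
  have hux : ¬ H.Adj u x := fun h => hW.not_adj u hu h.symm
  obtain ⟨W', hW', hxW', hmem⟩ := exists_isFarComponent hx (hW.ne u hu).symm hux
  have hpW : p ∉ W := hnotW p hvp
  have hpW' : p ∈ W' := hmem p
    (Relation.ReflTransGen.head ⟨⟨(hW.ne u hu).symm, hux⟩, hv⟩ (hfar p hvp))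
    (by rintro rfl; exact hpW hu) (hstep p u hpW hp.2.1 hp.2.2 hu)
  obtain ⟨z', hz'y, hz', w', hw', hwz'⟩ := hb.exists_attachment_ne (hW.subset u hu) hW' huy
  have hsame : ∀ φ : α → C, H.GoodOff f x φ → φ p = φ y := by
    intro φ hφ
    have hs := hb.critical.shift (hb.critical.shift hφ hy) huy.symm
    have h1 := (hb.color_eq hs hW' huy hz' hz'y.symm hxW' hy hw' hwz').1.trans
      (hb.color_eq hs hW' huy hz' hz'y.symm hpW' hpy hw' hwz').1.symm
    rw [Function.update_of_ne hy.1, Function.update_self, Function.update_of_ne hp.2.1,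
      Function.update_of_ne hp.1] at h1
    exact h1.symm
  obtain ⟨φ, hφ⟩ := hb.exists_goodOff x hx
  obtain ⟨ψ, hψ, h1, _, h3⟩ := hb.rotate hφ hW hy hz hyz hu huy hw hwz
  have h4 := hsame ψ hψ
  rw [h1, h3 p hpW hp.1 hp.2.1 hp.2.2, hsame φ hφ,
    (hb.color_eq hφ hW hy hz hyz hu huy hw hwz).1] at h4
  exact hb.attachment_pair_ne hφ hW hB h4

/-- A vertex that is not adjacent to all others has exactly two neighbors, which are the
attachments of any component of `H - N[x]`. -/
theorem CriticalBlock.exists_neighbor_pair (hb : H.CriticalBlock f P) (hx : x ∈ H.verts)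
    (hW : H.IsFarComponent x W) :
    ∃ y z, y ≠ z ∧ H.Adj x y ∧ H.Adj x z ∧ (∃ w ∈ W, H.Adj w y) ∧ (∃ w ∈ W, H.Adj w z) ∧
      (∀ t, H.Adj x t → t = y ∨ t = z) ∧ H.edgeMultiplicity x y = H.edgeMultiplicity x z := by
  obtain ⟨y, z, hyz, hy, hz, hyW, hzW, hB⟩ := hb.exists_attachment_pair hx hW
  refine ⟨y, z, hyz, hy, hz, hyW, hzW, ?_, ?_⟩
  · by_contra! ⟨v, hv, hvy, hvz⟩
    obtain ⟨t, ht, hr⟩ := (hb.nonSeparable x hx v hv.mem_right y hy.mem_right hv.1.symm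
      hy.1.symm).first_hit (T := {y, z}) (by simp)
    have hr' : H.Reach {t | t ≠ x ∧ t ≠ y ∧ t ≠ z} v t := hr.mono fun s hs => by
      simpa using hs
    rcases ht with rfl | rfl
    · exact hb.false_of_reach hx hW hyz hy hz hyW hzW hB hv hvy hvz hr'
    · exact hb.false_of_reach hx hW hyz.symm hz hy hzW hyW (fun s h1 h2 => (hB s h1 h2).symm) hv
        hvz hvy (hr'.mono fun s hs => ⟨hs.1, hs.2.2, hs.2.1⟩)
  · obtain ⟨φ, hφ⟩ := hb.exists_goodOff x hx
    obtain ⟨u, hu, huy⟩ := hyW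
    obtain ⟨w, hw, hwz⟩ := hzW
    exact (hb.color_eq hφ hW hy hz hyz hu huy hw hwz).2 (hb.attachment_pair_ne hφ hW hB)

/-- Seen from `w`, the universal vertex `x` is attached to every vertex of the far component of `u`.
Let `q` be another attachment, with neighbor `t` there. Then `t` is adjacent to both `x` and `q`, so
`color_eq` used both ways gives `x` and `q` the same color. They are the only two neighbors of `w`,
whose colors must differ. -/
theorem CriticalBlock.not_adj_all (hb : H.CriticalBlock f P) (hx : x ∈ H.verts) (hw : w ∈ H.verts)
    (hall : ∀ t ∈ H.verts, t ≠ x → H.Adj x t) (hu : u ∈ H.verts) (huw : u ≠ w)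
    (hadj : ¬ H.Adj w u) : False := by
  obtain ⟨W, hW, huW, _⟩ := exists_isFarComponent hu huw hadj
  have hwx : w ≠ x := by
    rintro rfl
    exact hadj (hall u hu huw)
  have hxw : H.Adj w x := (hall w hw hwx).symm
  have hxW := hW.notMem_of_adj hxw
  have hallW : ∀ t ∈ W, H.Adj t x := fun t ht =>
    (hall t (hW.subset t ht) (by rintro rfl; exact hxW ht)).symm
  obtain ⟨q, hqx, hq, t, ht, htq⟩ := hb.exists_attachment_ne hw hW hxw
  obtain ⟨φ, hφ⟩ := hb.exists_goodOff w hw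
  have h1 := (hb.color_eq hφ hW hxw hq hqx.symm ht (hallW t ht) ht htq).1
  have h2 := (hb.color_eq hφ hW hq hxw hqx ht htq ht (hallW t ht)).1
  obtain ⟨y, z, hyz, hy, hz, hyW, hzW, hN, _⟩ := hb.exists_neighbor_pair hw hW
  have hne := hb.attachment_pair_ne hφ hW (fun t ht _ => hN t ht)
  rcases hN x hxw with rfl | rfl <;> rcases hN q hq with rfl | rfl
  · exact hqx rfl
  · exact hne (h2.symm.trans h1)
  · exact hne (h1.symm.trans h2)
  · exact hqx rfl

theorem CriticalBlock.complete_or_two_neighbors (hb : H.CriticalBlock f P) :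
    (∀ x ∈ H.verts, ∀ y ∈ H.verts, x ≠ y → H.Adj x y) ∨
      ∀ x ∈ H.verts, ∃ y z, y ≠ z ∧ H.Adj x y ∧ H.Adj x z ∧ (∀ t, H.Adj x t → t = y ∨ t = z) ∧
        H.edgeMultiplicity x y = H.edgeMultiplicity x z := by
  by_cases h : ∀ x ∈ H.verts, ∀ y ∈ H.verts, x ≠ y → H.Adj x y
  · exact Or.inl h
  · refine Or.inr fun x hx => ?_
    push Not at h
    obtain ⟨w, hw, u, hu, hwu, hadj⟩ := h
    have hex : ∃ t ∈ H.verts, t ≠ x ∧ ¬ H.Adj x t := by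
      by_contra! hall
      exact hb.not_adj_all hx hw hall hu hwu.symm hadj
    obtain ⟨t, ht, htx, hxt⟩ := hex
    obtain ⟨W, hW, _⟩ := exists_isFarComponent ht htx hxt
    obtain ⟨y, z, h1, h2, h3, _, _, h4, h5⟩ := hb.exists_neighbor_pair hx hW
    exact ⟨y, z, h1, h2, h3, h4, h5⟩

end Blocks

end MultiHypergraph

/-- A cycle through all vertices of the single component yields a bijective homomorphism from a
cycle graph. It reflects adjacency because all neighborhoods on both sides have two elements. -/
theorem SimpleGraph.exists_iso_cycleGraph {V : Type*} [Finite V] (G : SimpleGraph V)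
    (hc : G.Connected) (h2 : ∀ v, (G.neighborSet v).ncard = 2) :
    ∃ n, 3 ≤ n ∧ Nonempty (SimpleGraph.cycleGraph n ≃g G) := by
  classical
  have := Fintype.ofFinite V
  obtain ⟨v⟩ := hc.nonempty
  have hne : (G.neighborSet v).Nonempty := by
    rw [← Set.ncard_pos, h2 v]; omega
  obtain ⟨p, hp, hsupp⟩ :=
    (show G.IsCycles from fun v _ => h2 v).exists_cycle_toSubgraph_verts_eq_connectedComponentSupp
      (c := G.connectedComponentMk v) (v := v) (by simp) hne
  have hlen := hp.three_le_length
  obtain ⟨c⟩ := (SimpleGraph.cycleGraph_isContained_iff (G := G) (n := p.length)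
    (by omega)).2 ⟨v, p, hp, rfl⟩
  have hcard : Fintype.card V ≤ p.length := by
    have hall : p.support.tail.toFinset = Finset.univ := by
      refine Finset.eq_univ_iff_forall.2 fun w => List.mem_toFinset.2 ?_
      have hw : w ∈ p.toSubgraph.verts := by
        rw [hsupp, SimpleGraph.ConnectedComponent.mem_supp_iff, SimpleGraph.ConnectedComponent.eq]
        exact hc.preconnected w v
      rw [SimpleGraph.Walk.mem_verts_toSubgraph, SimpleGraph.Walk.mem_support_iff] at hw
      rcases hw with rfl | hw
      · exact p.end_mem_tail_support hp.not_nil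
      · exact hw
    rw [← Finset.card_univ, ← hall]
    refine (List.toFinset_card_le _).trans ?_
    simp
  refine ⟨p.length, hlen, ?_⟩
  have hinj : Function.Injective c := c.injective
  have hbij : Function.Bijective c :=
    (Fintype.bijective_iff_injective_and_card c).2 ⟨hinj, le_antisymm
      (Fintype.card_le_of_injective c hinj) (by simpa using hcard)⟩
  refine ⟨⟨Equiv.ofBijective c hbij, ?_⟩⟩
  intro i j
  change G.Adj (c i) (c j) ↔ _
  have hdeg : ((SimpleGraph.cycleGraph p.length).neighborSet i).ncard = 2 := by
    obtain ⟨m, hm⟩ : ∃ m, p.length = m + 3 := ⟨p.length - 3, by omega⟩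
    generalize p.length = l at *
    subst hm
    rw [← SimpleGraph.coe_neighborFinset, Set.ncard_coe_finset]
    exact SimpleGraph.cycleGraph_degree_three_le
  have himg : c '' (SimpleGraph.cycleGraph p.length).neighborSet i = G.neighborSet (c i) := by
    refine Set.eq_of_subset_of_ncard_le ?_ ?_
    · rintro _ ⟨j, hj, rfl⟩
      exact c.toHom.map_adj hj
    · rw [Set.ncard_image_of_injective _ hinj, hdeg, h2]
  constructor
  · intro h
    have : c j ∈ c '' (SimpleGraph.cycleGraph p.length).neighborSet i := himg ▸ h
    obtain ⟨j', hj', hjj⟩ := this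
    exact hinj hjj ▸ hj'
  · exact fun h => c.toHom.map_adj h

namespace MultiHypergraph

/-! ### Critical blocks are multiples of complete graphs or odd cycles -/

section Structure

open Classical

variable {α β C : Type*} {H : MultiHypergraph α β} {f : α → C → ℕ} {P : Finset C}
  {x y z : α}

theorem CriticalBlock.exists_adj (hb : H.CriticalBlock f P) (hx : x ∈ H.verts) (y : α) :
    ∃ z, z ≠ y ∧ H.Adj x z := by
  obtain ⟨φ, hφ⟩ := hb.exists_goodOff x hx
  obtain ⟨b, hne, hbp⟩ := hb.exists_color_ne x hx (φ y)
  obtain ⟨z, hz, hzb⟩ := hb.critical.exists_adj hφ hbp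
  exact ⟨z, by rintro rfl; exact hne hzb.symm, hz⟩

/-- Non-separability speaks only of walks avoiding some vertex; a neighbor of `x` other than `y`
serves as the one to avoid. -/
theorem CriticalBlock.reach_univ (hb : H.CriticalBlock f P) (hx : x ∈ H.verts)
    (hy : y ∈ H.verts) : H.Reach Set.univ x y := by
  obtain ⟨z, hzy, hz⟩ := hb.exists_adj hx y
  exact (hb.nonSeparable z hz.mem_right x hx y hy hz.1 hzy.symm).mono (Set.subset_univ _)

theorem CriticalBlock.pos_of_mem (hb : H.CriticalBlock f P) (hx : x ∈ H.verts) (hy : y ∈ H.verts)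
    {c : C} (hc : 0 < f x c) : 0 < f y c := by
  have hr := hb.reach_univ hx hy
  clear hy
  induction hr with
  | refl => exact hc
  | tail _ hs ih =>
    obtain ⟨φ, hφ⟩ := hb.exists_goodOff _ hs.2.mem_left
    exact hb.critical.pos_of_pos hb.nonSeparable hφ hs.2 ih

/-- Moving the hole around the triangle `x, y, z` swaps the colors of `y` and `z`, so `exchange`
applies if they differ. Otherwise compare both with a neighbor of another color. -/
theorem CriticalBlock.edgeMultiplicity_eq_of_complete (hb : H.CriticalBlock f P)
    (hall : ∀ x ∈ H.verts, ∀ y ∈ H.verts, x ≠ y → H.Adj x y) (hxy : H.Adj x y) (hxz : H.Adj x z) :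
    H.edgeMultiplicity x y = H.edgeMultiplicity x z := by
  obtain ⟨φ, hφ⟩ := hb.exists_goodOff x hxy.mem_left
  have key : ∀ y z, H.Adj x y → H.Adj x z → φ y ≠ φ z →
      H.edgeMultiplicity x y = H.edgeMultiplicity x z := by
    intro y z hy hz hne
    have hyz : y ≠ z := fun h => hne (h ▸ rfl)
    have hyz' := hall y hy.mem_right z hz.mem_right hyz
    have hs := hb.critical.shift (hb.critical.shift (hb.critical.shift hφ hy) hyz') hz.symm
    refine (hb.exchange hφ hs hy hz hyz (fun t ht hty htz => ?_) ?_).2 hne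
    · rw [Function.update_of_ne htz, Function.update_of_ne hty, Function.update_of_ne ht.1.symm]
    · rw [Function.update_self, Function.update_of_ne hy.1, Function.update_self]
  by_cases h : φ y = φ z
  · obtain ⟨b, hne, hbp⟩ := hb.exists_color_ne x hxy.mem_left (φ y)
    obtain ⟨w, hw, hwb⟩ := hb.critical.exists_adj hφ hbp
    rw [key y w hxy hw (by rw [hwb]; exact hne.symm),
      key z w hxz hw (by rw [hwb, ← h]; exact hne.symm)]
  · exact key y z hxy hxz h

/-- A critical block is a multiple of a complete graph or a multiple of a cycle. -/
theorem CriticalBlock.structure (hb : H.CriticalBlock f P) (hne : H.verts.Nonempty) :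
    ∃ t, 1 ≤ t ∧ ((∀ x ∈ H.verts, ∀ y ∈ H.verts, x ≠ y → H.edgeMultiplicity x y = t) ∨
      ((∀ x y, H.Adj x y → H.edgeMultiplicity x y = t) ∧
        ∀ x ∈ H.verts, ∃ y z, y ≠ z ∧ H.Adj x y ∧ H.Adj x z ∧ ∀ w, H.Adj x w → w = y ∨ w = z)) := by
  obtain ⟨x, hx⟩ := hne
  obtain ⟨y, -, hxy⟩ := hb.exists_adj hx x
  refine ⟨H.edgeMultiplicity x y, edgeMultiplicity_pos hb.card_inc_eq_two hxy, ?_⟩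
  have hconst : (∀ u v w, H.Adj u v → H.Adj u w →
      H.edgeMultiplicity u v = H.edgeMultiplicity u w) →
      ∀ u v, H.Adj u v → H.edgeMultiplicity u v = H.edgeMultiplicity x y := by
    intro h u v huv
    have hr := hb.reach_univ hx huv.mem_left
    induction hr generalizing v with
    | refl => exact h _ _ _ huv hxy
    | tail _ hs ih => rw [h _ _ _ huv hs.2.symm, edgeMultiplicity_comm, ih _ hs.2]
  rcases hb.complete_or_two_neighbors with hall | htwo
  · refine Or.inl fun u hu v hv huv => hconst (fun u v w h1 h2 => ?_) u v (hall u hu v hv huv)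
    exact hb.edgeMultiplicity_eq_of_complete hall h1 h2
  · refine Or.inr ⟨hconst fun u v w h1 h2 => ?_, fun u hu => ?_⟩
    · obtain ⟨p, q, _, _, _, hN, heq⟩ := htwo u h1.mem_left
      rcases hN v h1 with rfl | rfl <;> rcases hN w h2 with rfl | rfl <;> first
        | rfl
        | exact heq
        | exact heq.symm
    · obtain ⟨p, q, h1, h2, h3, h4, _⟩ := htwo u hu
      exact ⟨p, q, h1, h2, h3, h4⟩

theorem CriticalBlock.exists_degree_eq (hb : H.CriticalBlock f P) (hne : H.verts.Nonempty) :
    ∃ d, ∀ x ∈ H.verts, H.degree x = d := by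
  obtain ⟨t, _, h | ⟨ht, h⟩⟩ := hb.structure hne
  · refine ⟨(H.verts.card - 1) * t, fun x hx => ?_⟩
    rw [degree_eq_sum hb.card_inc_eq_two, Finset.sum_congr rfl (g := fun _ => t),
      Finset.sum_const, Finset.card_erase_of_mem hx, smul_eq_mul]
    intro u hu
    exact h x hx u (Finset.mem_erase.1 hu).2 (Finset.mem_erase.1 hu).1.symm
  · refine ⟨t + t, fun x hx => ?_⟩
    obtain ⟨y, z, hyz, hy, hz, hN⟩ := h x hx
    rw [degree_eq_sum hb.card_inc_eq_two, ← Finset.sum_subset (s₁ := {y, z}), Finset.sum_pair hyz,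
      ht _ _ hy, ht _ _ hz]
    · intro u hu
      rcases Finset.mem_insert.1 hu with rfl | hu
      · exact Finset.mem_erase.2 ⟨hy.1.symm, hy.mem_right⟩
      · rw [Finset.mem_singleton.1 hu]
        exact Finset.mem_erase.2 ⟨hz.1.symm, hz.mem_right⟩
    · intro u hu huN
      refine edgeMultiplicity_eq_zero (Finset.mem_erase.1 hu).1.symm fun hadj => huN ?_
      rcases hN u hadj with rfl | rfl <;> simp

theorem CriticalBlock.isMultipleOf (hb : H.CriticalBlock f P) (hne : H.verts.Nonempty) :
    ∃ t n, 1 ≤ t ∧ ((1 ≤ n ∧ H.IsMultipleOf t (⊤ : SimpleGraph (Fin n))) ∨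
      (3 ≤ n ∧ Odd n ∧ H.IsMultipleOf t (SimpleGraph.cycleGraph n))) := by
  obtain ⟨t, ht1, h | ⟨ht, h⟩⟩ := hb.structure hne
  · refine ⟨t, H.verts.card, ht1, Or.inl ⟨hne.card_pos, hb.card_inc_eq_two,
      H.verts.equivFin.symm, fun i j hij => ?_⟩⟩
    rw [if_pos (by simpa using hij)]
    exact h _ (Subtype.prop _) _ (Subtype.prop _) fun heq =>
      hij (H.verts.equivFin.symm.injective (Subtype.ext heq))
  · let G : SimpleGraph {v : α // v ∈ H.verts} :=
      { Adj := fun a b => H.Adj a b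
        symm := ⟨fun _ _ h => h.symm⟩
        loopless := ⟨fun _ h => h.1 rfl⟩ }
    have hG2 : ∀ a, (G.neighborSet a).ncard = 2 := by
      rintro ⟨x, hx⟩
      obtain ⟨y, z, hyz, hy, hz, hN⟩ := h x hx
      have : G.neighborSet ⟨x, hx⟩ = {⟨y, hy.mem_right⟩, ⟨z, hz.mem_right⟩} := by
        ext ⟨w, hw⟩
        simp only [SimpleGraph.mem_neighborSet, Set.mem_insert_iff, Set.mem_singleton_iff,
          Subtype.mk.injEq]
        refine ⟨fun hxw => hN w hxw, ?_⟩
        rintro (rfl | rfl)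
        · exact hy
        · exact hz
      rw [this, Set.ncard_pair (by simpa using hyz)]
    have hGc : G.Connected := by
      obtain ⟨x, hx⟩ := hne
      have : Nonempty {v : α // v ∈ H.verts} := ⟨⟨x, hx⟩⟩
      refine ⟨fun a b => ?_⟩
      have hr := hb.reach_univ a.2 b.2
      have hgen : ∀ w, H.Reach Set.univ a.1 w → ∀ hw : w ∈ H.verts, G.Reachable a ⟨w, hw⟩ := by
        intro w hw
        induction hw with
        | refl => exact fun _ => SimpleGraph.Reachable.refl _
        | tail _ hs ih =>
          exact fun hc => (ih hs.2.mem_left).trans (SimpleGraph.Adj.reachable (G := G) hs.2)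
      exact hgen b.1 hr b.2
    obtain ⟨n, hn, ⟨σ⟩⟩ := G.exists_iso_cycleGraph hGc hG2
    refine ⟨t, n, ht1, Or.inr ⟨hn, ?_, hb.card_inc_eq_two, σ.toEquiv, fun i j hij => ?_⟩⟩
    -- Two colors with positive capacity at `x` have it everywhere by `pos_of_mem`. On an even cycle
    -- they give a proper coloring, which is good because no edge lies inside a color class.
    · by_contra hodd
      obtain ⟨x, hx⟩ := hne
      obtain ⟨φ, hφ⟩ := hb.exists_goodOff x hx
      obtain ⟨a, -, ha⟩ := hb.exists_color_ne x hx (φ x)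
      obtain ⟨b, hba, hb'⟩ := hb.exists_color_ne x hx a
      let χ := SimpleGraph.cycleGraph.bicoloring_of_even n (Nat.not_odd_iff_even.1 hodd)
      let ψ : α → C := fun v =>
        if hv : v ∈ H.verts then (if χ (σ.symm ⟨v, hv⟩) then a else b) else a
      refine hb.critical.not_good ψ fun X hX hXne c hc => ?_
      obtain ⟨u, hu⟩ := hXne
      refine ⟨u, hu, ?_⟩
      have hpos : 0 < f u c := by
        rw [← hc u hu]
        refine hb.pos_of_mem hx (hX hu) ?_
        simp only [ψ, dif_pos (hX hu)]
        split_ifs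
        · exact ha
        · exact hb'
      refine lt_of_le_of_lt (le_of_eq ?_) hpos
      refine Finset.card_eq_zero.2 (Finset.filter_eq_empty_iff.2 fun e he ⟨hue, heX⟩ => ?_)
      obtain ⟨w, hw, hwu⟩ := exists_other he u
      have hadj : G.Adj ⟨u, hX hu⟩ ⟨w, hX (heX hw)⟩ := ⟨hwu.symm, e, he, hue, hw⟩
      have hcol := χ.valid (σ.symm.map_adj_iff.2 hadj)
      have heq := (hc u hu).trans (hc w (heX hw)).symm
      simp only [ψ, dif_pos (hX hu), dif_pos (hX (heX hw))] at heq
      apply hcol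
      split_ifs at heq with h1 h2 h2
      · exact h1.trans h2.symm
      · exact absurd heq.symm hba
      · exact absurd heq hba
      · rw [Bool.not_eq_true] at h1 h2
        exact h1.trans h2.symm
    · change H.edgeMultiplicity (σ i) (σ j) = _
      by_cases hadj : (SimpleGraph.cycleGraph n).Adj i j
      · rw [if_pos hadj]
        exact ht _ _ (σ.map_adj_iff.2 hadj)
      · rw [if_neg hadj]
        refine edgeMultiplicity_eq_zero (fun h => hij (σ.injective (Subtype.ext h))) fun h => hadj ?_
        exact σ.map_adj_iff.1 h

end Structure

end MultiHypergraph

namespace MultiHypergraph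

/-! ### Excluding cut vertices -/

section Separation

open Classical

variable {α β C : Type*} {H : MultiHypergraph α β} {f : α → C → ℕ} {P : Finset C} {ψ : α → C}
  {x u v : α} {D : Finset α}

/-- The vertex `x` separates the vertex set `D` from a nonempty set of other vertices. -/
structure Separates (H : MultiHypergraph α β) (x : α) (D : Finset α) : Prop where
  mem : x ∈ H.verts
  subset : D ⊆ H.verts.erase x
  nonempty : D.Nonempty
  ne : D ≠ H.verts.erase x
  closed : ∀ e ∈ H.edges, ∀ u ∈ H.inc e, u ∈ D → H.inc e ⊆ insert x D

theorem nonSeparable_of_not_separates (h : ∀ x D, ¬ H.Separates x D) : H.NonSeparable := by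
  intro x hx y hy z hz hyx hzx
  by_contra hr
  refine h x ((H.verts.erase x).filter (fun t => H.Reach {x}ᶜ y t))
    ⟨hx, Finset.filter_subset _ _, ⟨y, ?_⟩, fun heq => hr ?_, fun e he u hu huD w hw => ?_⟩
  · exact Finset.mem_filter.2 ⟨Finset.mem_erase.2 ⟨hyx, hy⟩, Relation.ReflTransGen.refl⟩
  · have hz' : z ∈ H.verts.erase x := Finset.mem_erase.2 ⟨hzx, hz⟩
    rw [← heq] at hz'
    exact (Finset.mem_filter.1 hz').2
  · rw [Finset.mem_filter, Finset.mem_erase] at huD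
    by_cases hwx : w = x
    · exact hwx ▸ Finset.mem_insert_self _ _
    refine Finset.mem_insert_of_mem (Finset.mem_filter.2
      ⟨Finset.mem_erase.2 ⟨hwx, H.inc_subset e he hw⟩, ?_⟩)
    by_cases hwu : w = u
    · exact hwu ▸ huD.2
    · exact Relation.ReflTransGen.tail huD.2 ⟨huD.1.1, Ne.symm hwu, e, he, hu, hw⟩

theorem Connected.exists_goodOn (hconn : H.Connected) [Nonempty C]
    (hd : ∀ x ∈ H.verts, H.degree x ≤ ∑ c ∈ P, f x c) (A : Finset α) (hA : A ⊂ H.verts) :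
    ∃ φ : α → C, H.GoodOn f A φ := by
  refine MultiHypergraph.exists_goodOn hd A hA.1 fun X hX hne => ?_
  obtain ⟨e, he, hu, w, hw, hwX⟩ := hconn.2 X hne (hX.trans_ssubset hA)
  exact ⟨e, he, hu, fun h => hwX (h hw)⟩

theorem Connected.exists_goodOff (hconn : H.Connected) [Nonempty C]
    (hd : ∀ x ∈ H.verts, H.degree x ≤ ∑ c ∈ P, f x c) (hx : x ∈ H.verts) :
    ∃ φ : α → C, H.GoodOff f x φ := by
  obtain ⟨φ, hφ⟩ := hconn.exists_goodOn hd _ (Finset.erase_ssubset hx)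
  exact ⟨φ, hx, hφ⟩

theorem Separates.verts_induce (hs : H.Separates v D) :
    (H.induce (insert v D)).verts = insert v D := by
  ext u
  simp only [induce, Finset.mem_filter, and_iff_right_iff_imp]
  intro hu
  rcases Finset.mem_insert.1 hu with rfl | hu
  · exact hs.mem
  · exact (Finset.mem_erase.1 (hs.subset hu)).2

theorem mem_edges_induce {X : Finset α} {e : β} :
    e ∈ (H.induce X).edges ↔ e ∈ H.edges ∧ H.inc e ⊆ X := by
  simp [induce]

theorem Separates.notMem (hs : H.Separates v D) : v ∉ D :=
  fun h => (Finset.mem_erase.1 (hs.subset h)).1 rfl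

theorem Separates.subset_verts (hs : H.Separates v D) : D ⊆ H.verts :=
  fun _ h => (Finset.mem_erase.1 (hs.subset h)).2

theorem Separates.connected_induce (hs : H.Separates v D) (hconn : H.Connected) :
    (H.induce (insert v D)).Connected := by
  have key : ∀ X ⊆ D, X.Nonempty → ∃ e ∈ (H.induce (insert v D)).edges,
      (∃ u ∈ H.inc e, u ∈ X) ∧ ∃ w ∈ H.inc e, w ∉ X := by
    intro X hX hne
    have hss : X ⊂ H.verts := by
      refine ⟨hX.trans hs.subset_verts, fun h => hs.notMem (hX (h hs.mem))⟩
    obtain ⟨e, he, ⟨u, hu, huX⟩, hw⟩ := hconn.2 X hne hss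
    exact ⟨e, mem_edges_induce.2 ⟨he, hs.closed e he u hu (hX huX)⟩, ⟨u, hu, huX⟩, hw⟩
  refine ⟨fun h => ?_, fun X hne hss => ?_⟩
  · have := h.1
    rw [hs.verts_induce] at this
    exact Finset.insert_ne_empty _ _ this
  · rw [hs.verts_induce] at hss
    by_cases hv : v ∈ X
    · obtain ⟨t, ht, htX⟩ := Finset.exists_of_ssubset hss
      obtain ⟨e, he, ⟨u, hu, huY⟩, w, hw, hwY⟩ := key (insert v D \ X) (fun u hu => by
        rw [Finset.mem_sdiff, Finset.mem_insert] at hu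
        rcases hu.1 with rfl | h
        · exact absurd hv hu.2
        · exact h) ⟨t, Finset.mem_sdiff.2 ⟨ht, htX⟩⟩
      refine ⟨e, he, ⟨w, hw, ?_⟩, u, hu, (Finset.mem_sdiff.1 huY).2⟩
      by_contra hwX
      exact hwY (Finset.mem_sdiff.2 ⟨(mem_edges_induce.1 he).2 hw, hwX⟩)
    · exact key X (fun u hu => (Finset.mem_insert.1 (hss.1 hu)).resolve_left
        (by rintro rfl; exact hv hu)) hne

/-- If `D` is as small as possible, then `H[D ∪ {v}]` has no separating vertex. -/
theorem Separates.nonSeparable_induce (hs : H.Separates v D)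
    (hmin : ∀ x D', H.Separates x D' → D.card ≤ D'.card) :
    (H.induce (insert v D)).NonSeparable := by
  -- A set inside `D` cut off by a vertex of `D` is also cut off in `H`, and is smaller than `D`.
  have key : ∀ x ∈ D, ∀ D₁ ⊆ D.erase x, D₁.Nonempty →
      (∀ e ∈ (H.induce (insert v D)).edges, ∀ u ∈ H.inc e, u ∈ D₁ → H.inc e ⊆ insert x D₁) →
      False := by
    intro x hx D₁ hD₁ hne hcl
    have hlt : D₁.card < D.card :=
      lt_of_le_of_lt (Finset.card_le_card hD₁) (Finset.card_erase_lt_of_mem hx)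
    refine absurd (hmin x D₁ ⟨hs.subset_verts hx, hD₁.trans (Finset.erase_subset_erase _
      hs.subset_verts), hne, fun heq => ?_, fun e he u hu huD => ?_⟩) (not_le.2 hlt)
    · have hv : v ∈ D₁ := by
        rw [heq]
        exact Finset.mem_erase.2 ⟨by rintro rfl; exact hs.notMem hx, hs.mem⟩
      exact hs.notMem (Finset.mem_erase.1 (hD₁ hv)).2
    · exact hcl e (mem_edges_induce.2 ⟨he, hs.closed e he u hu (Finset.mem_erase.1 (hD₁ huD)).2⟩)
        u hu huD
  refine nonSeparable_of_not_separates fun x D₁ h₁ => ?_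
  have hsub := h₁.subset
  have hneq := h₁.ne
  have hx := h₁.mem
  rw [hs.verts_induce] at hsub hneq hx
  by_cases hxv : x = v
  · subst hxv
    rw [Finset.erase_insert hs.notMem] at hsub hneq
    have hlt : D₁.card < D.card := Finset.card_lt_card (lt_of_le_of_ne hsub hneq)
    refine absurd (hmin x D₁ ⟨hs.mem, hsub.trans hs.subset, h₁.nonempty, fun heq => ?_,
      fun e he u hu huD => ?_⟩) (not_le.2 hlt)
    · exact hneq (subset_antisymm hsub (heq ▸ hs.subset))
    · exact h₁.closed e (mem_edges_induce.2 ⟨he, hs.closed e he u hu (hsub huD)⟩) u hu huD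
  have hxD : x ∈ D := (Finset.mem_insert.1 hx).resolve_left hxv
  by_cases hv : v ∈ D₁
  -- If the side `D₁` contains `v`, the other side avoids it and is the one to use.
  · refine key x hxD ((insert v D).erase x \ D₁) (fun u hu => ?_) ?_ fun e he u hu huD w hw => ?_
    · simp only [Finset.mem_sdiff, Finset.mem_erase, Finset.mem_insert] at hu
      exact Finset.mem_erase.2 ⟨hu.1.1, hu.1.2.resolve_left (by rintro rfl; exact hu.2 hv)⟩
    · rw [Finset.sdiff_nonempty]
      exact fun h => hneq (subset_antisymm hsub h)
    · by_cases hwx : w = x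
      · exact hwx ▸ Finset.mem_insert_self _ _
      refine Finset.mem_insert_of_mem (Finset.mem_sdiff.2 ⟨Finset.mem_erase.2
        ⟨hwx, (mem_edges_induce.1 he).2 hw⟩, fun hwD => ?_⟩)
      rw [Finset.mem_sdiff, Finset.mem_erase] at huD
      rcases Finset.mem_insert.1 (h₁.closed e he w hw hwD hu) with h | h
      · exact huD.1.1 h
      · exact huD.2 h
  · refine key x hxD D₁ (fun u hu => ?_) h₁.nonempty h₁.closed
    have := Finset.mem_erase.1 (hsub hu)
    exact Finset.mem_erase.2 ⟨this.1, (Finset.mem_insert.1 this.2).resolve_left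
      (by rintro rfl; exact hv hu)⟩

theorem Separates.degree_induce_of_mem (hs : H.Separates v D) (hu : u ∈ D) :
    (H.induce (insert v D)).degree u = H.degree u := by
  unfold degree
  congr 1
  ext e
  simp only [Finset.mem_filter, mem_edges_induce]
  exact ⟨fun h => ⟨h.1.1, h.2⟩, fun h => ⟨⟨h.1, hs.closed e h.1 u h.2 hu⟩, h.2⟩⟩

/-- The edges at `v` that do not lie in `H[D ∪ {v}]`. -/
noncomputable def outerEdges (H : MultiHypergraph α β) (v : α) (D : Finset α) : Finset β :=
  H.edges.filter (fun e => v ∈ H.inc e ∧ ¬ H.inc e ⊆ insert v D)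

theorem degree_induce_add (v : α) (D : Finset α) :
    (H.induce (insert v D)).degree v + (H.outerEdges v D).card = H.degree v := by
  unfold degree outerEdges
  rw [← Finset.card_filter_add_card_filter_not (s := H.edges.filter (fun e => v ∈ H.inc e))
    (fun e => H.inc e ⊆ insert v D), Finset.filter_filter, Finset.filter_filter]
  congr 2
  ext e
  simp only [Finset.mem_filter, mem_edges_induce]
  exact ⟨fun h => ⟨h.1.1, h.2, h.1.2⟩, fun h => ⟨⟨h.1, h.2.2⟩, h.2.1⟩⟩

theorem Separates.outerEdges_nonempty (hs : H.Separates v D) (hconn : H.Connected) :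
    (H.outerEdges v D).Nonempty := by
  have hne : (H.verts \ insert v D).Nonempty := by
    rw [Finset.sdiff_nonempty]
    intro h
    refine hs.ne (subset_antisymm hs.subset fun u hu => ?_)
    rw [Finset.mem_erase] at hu
    exact (Finset.mem_insert.1 (h hu.2)).resolve_left hu.1
  obtain ⟨e, he, ⟨u, hu, huX⟩, w, hw, hwX⟩ := hconn.2 _ hne
    ⟨Finset.sdiff_subset, fun h => (Finset.mem_sdiff.1 (h hs.mem)).2 (Finset.mem_insert_self _ _)⟩
  have huD := (Finset.mem_sdiff.1 huX).2
  refine ⟨e, Finset.mem_filter.2 ⟨he, ?_, fun h => huD (h hu)⟩⟩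
  by_cases hwv : w = v
  · exact hwv ▸ hw
  have hwD : w ∈ D := by
    by_contra hwD
    refine hwX (Finset.mem_sdiff.2 ⟨H.inc_subset e he hw, fun h => ?_⟩)
    exact (Finset.mem_insert.1 h).elim hwv hwD
  exact absurd (hs.closed e he w hw hwD hu) huD

/-- The capacities at the vertices of `H[D ∪ {v}]` that remain available when the rest of `H` is
colored by `ψ`. -/
noncomputable def innerCapacity (H : MultiHypergraph α β) (f : α → C → ℕ) (v : α) (D : Finset α)
    (ψ : α → C) (u : α) (c : C) : ℕ :=
  if u = v then f v c - (H.outerEdges v D ∩ H.monoEdges ψ v c).card else f u c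

/-- A good coloring of the piece would combine with `ψ` to one of `H`, since the outer edges at `v`
that may become monochromatic have been charged to its capacities. In total this charge is at most
the degree that `v` loses. -/
theorem Separates.critical_induce (hs : H.Separates v D) (hcr : H.Critical f P)
    (hψ : H.GoodOn f (H.verts \ insert v D) ψ) :
    (H.induce (insert v D)).Critical (H.innerCapacity f v D ψ) P := by
  refine ⟨fun u hu => ?_, fun u hu c hc => ?_, fun φ hφ => ?_⟩
  · rw [hs.verts_induce] at hu
    by_cases huv : u = v
    · subst huv
      have h1 := degree_induce_add (H := H) u D
      have h2 := hcr.degree_le u hs.mem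
      have h3 : ∑ c ∈ P, (H.outerEdges u D ∩ H.monoEdges ψ u c).card ≤ (H.outerEdges u D).card :=
        sum_card_le_card P _ _ (fun c _ => Finset.inter_subset_left) (fun c _ d _ e h1 h2 =>
          monoEdges_color_unique (Finset.mem_inter.1 h1).2 (Finset.mem_inter.1 h2).2)
      -- Truncated subtraction is harmless: the bound needs only `f ≤ (f - n) + n`.
      have h4 : ∑ c ∈ P, f u c ≤ ∑ c ∈ P, (H.innerCapacity f u D ψ u c +
          (H.outerEdges u D ∩ H.monoEdges ψ u c).card) := by
        refine Finset.sum_le_sum fun c _ => ?_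
        rw [innerCapacity, if_pos rfl]
        omega
      rw [Finset.sum_add_distrib] at h4
      omega
    · have huD := (Finset.mem_insert.1 hu).resolve_left huv
      rw [hs.degree_induce_of_mem huD]
      simpa only [innerCapacity, if_neg huv] using hcr.degree_le u (hs.subset_verts huD)
  · rw [hs.verts_induce] at hu
    unfold innerCapacity
    split_ifs with huv
    · rw [hcr.eq_zero v hs.mem c hc, Nat.zero_sub]
    · exact hcr.eq_zero u (hs.subset_verts ((Finset.mem_insert.1 hu).resolve_left huv)) c hc
  · rw [hs.verts_induce] at hφ
    refine hcr.not_good (fun u => if u ∈ insert v D then φ u else ψ u) fun X hX hne c hc => ?_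
    beta_reduce at hc
    rcases (X ∩ insert v D).eq_empty_or_nonempty with hempty | hYne
    · have hnot : ∀ u ∈ X, u ∉ insert v D := fun u hu h => by
        have : u ∈ X ∩ insert v D := Finset.mem_inter.2 ⟨hu, h⟩
        rw [hempty] at this
        exact absurd this (Finset.notMem_empty u)
      refine hψ X (fun u hu => Finset.mem_sdiff.2 ⟨hX hu, hnot u hu⟩) hne c fun u hu => ?_
      have := hc u hu
      rwa [if_neg (hnot u hu)] at this
    · obtain ⟨u, hu, hlt⟩ := hφ (X ∩ insert v D) Finset.inter_subset_right hYne c fun u hu => by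
        have := hc u (Finset.mem_inter.1 hu).1
        rwa [if_pos (Finset.mem_inter.1 hu).2] at this
      have hu' := Finset.mem_inter.1 hu
      refine ⟨u, hu'.1, ?_⟩
      by_cases huv : u = v
      · subst huv
        rw [innerCapacity, if_pos rfl] at hlt
        have hle : H.degIn X u ≤ (H.induce (insert u D)).degIn (X ∩ insert u D) u +
            (H.outerEdges u D ∩ H.monoEdges ψ u c).card := by
          refine (Finset.card_le_card ?_).trans (Finset.card_union_le _ _)
          intro e he
          rw [Finset.mem_filter] at he
          by_cases hsub : H.inc e ⊆ insert u D
          · exact Finset.mem_union_left _ (Finset.mem_filter.2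
              ⟨mem_edges_induce.2 ⟨he.1, hsub⟩, he.2.1, Finset.subset_inter he.2.2 hsub⟩)
          · refine Finset.mem_union_right _ (Finset.mem_inter.2 ⟨Finset.mem_filter.2
              ⟨he.1, he.2.1, hsub⟩, Finset.mem_filter.2 ⟨he.1, he.2.1, fun w hw hwu => ?_⟩⟩)
            have hwc := hc w (he.2.2 hw)
            rwa [if_neg fun hwD => hsub (hs.closed e he.1 w hw
              ((Finset.mem_insert.1 hwD).resolve_left hwu))] at hwc
        omega
      · rw [innerCapacity, if_neg huv] at hlt
        refine lt_of_le_of_lt (Finset.card_le_card ?_) hlt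
        intro e he
        rw [Finset.mem_filter] at he
        have hsub := hs.closed e he.1 u he.2.1 ((Finset.mem_insert.1 hu'.2).resolve_left huv)
        exact Finset.mem_filter.2 ⟨mem_edges_induce.2 ⟨he.1, hsub⟩, he.2.1,
          Finset.subset_inter he.2.2 hsub⟩

/-- A connected critical hypergraph with constant total capacity has no separating vertex. -/
theorem Critical.nonSeparable (hcr : H.Critical f P) (hconn : H.Connected) [Nonempty C]
    (hcol : ∀ x ∈ H.verts, ∀ a, ∃ b, b ≠ a ∧ 0 < f x b) (N : ℕ)
    (hN : ∀ x ∈ H.verts, ∑ c ∈ P, f x c = N) : H.NonSeparable := by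
  refine nonSeparable_of_not_separates fun x₀ D₀ hs₀ => ?_
  have hex : ∃ n v D, H.Separates v D ∧ D.card = n := ⟨_, x₀, D₀, hs₀, rfl⟩
  obtain ⟨v, D, hs, hcard⟩ := Nat.find_spec hex
  have hmin : ∀ x D', H.Separates x D' → D.card ≤ D'.card := fun x D' h' =>
    hcard.trans_le (Nat.find_min' hex ⟨x, D', h', rfl⟩)
  obtain ⟨ψ, hψ⟩ := hconn.exists_goodOn hcr.degree_le (H.verts \ insert v D)
    ⟨Finset.sdiff_subset, fun h => (Finset.mem_sdiff.1 (h hs.mem)).2 (Finset.mem_insert_self _ _)⟩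
  have hcr' := hs.critical_induce hcr hψ
  have hconn' := hs.connected_induce hconn
  have hns' := hs.nonSeparable_induce hmin
  have hverts := hs.verts_induce
  have hcap : ∀ u ∈ D, ∀ c, H.innerCapacity f v D ψ u c = f u c := fun u hu c =>
    if_neg (by rintro rfl; exact hs.notMem hu)
  have hcolD : ∀ u ∈ D, ∀ a, ∃ b, b ≠ a ∧ 0 < H.innerCapacity f v D ψ u b := fun u hu a => by
    obtain ⟨b, hba, hb⟩ := hcol u (hs.subset_verts hu) a
    exact ⟨b, hba, by rwa [hcap u hu]⟩
  have hvD : v ∈ (H.induce (insert v D)).verts := by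
    rw [hverts]
    exact Finset.mem_insert_self _ _
  have hblock : (H.induce (insert v D)).CriticalBlock (H.innerCapacity f v D ψ) P := by
    refine ⟨hcr', hns', fun x hx => hconn'.exists_goodOff hcr'.degree_le hx, fun x hx a => ?_⟩
    rw [hverts] at hx
    rcases Finset.mem_insert.1 hx with rfl | hxD
    -- The reduced capacities at the cut vertex might have lost colors; `pos_of_pos` transfers a
    -- positive color from a neighbor in `D`.
    · obtain ⟨e, he, ⟨u, hu, huD⟩, w, hw, hwD⟩ := hconn'.2 D hs.nonempty (by
        rw [hverts]
        exact Finset.ssubset_insert hs.notMem)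
      have hwx : w = x := (Finset.mem_insert.1 ((mem_edges_induce.1 he).2 hw)).resolve_right hwD
      subst hwx
      have hadj : (H.induce (insert w D)).Adj u w :=
        ⟨fun h => hwD (h ▸ huD), e, he, hu, hw⟩
      obtain ⟨φ, hφ⟩ := hconn'.exists_goodOff hcr'.degree_le hadj.mem_left
      obtain ⟨b, hba, hb⟩ := hcolD u huD a
      exact ⟨b, hba, hcr'.pos_of_pos hns' hφ hadj hb⟩
    · exact hcolD x hxD a
  -- Vertices of `D` keep their full capacity, so the common degree `d` is `N`; but `v` has at least
  -- one outer edge in addition.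
  obtain ⟨d, hd⟩ := hblock.exists_degree_eq ⟨v, hvD⟩
  obtain ⟨u, hu⟩ := hs.nonempty
  have huD : u ∈ (H.induce (insert v D)).verts := by
    rw [hverts]
    exact Finset.mem_insert_of_mem hu
  obtain ⟨φ, hφ⟩ := hblock.exists_goodOff u huD
  have h1 := hcr'.degree_eq hφ
  rw [Finset.sum_congr rfl (fun c _ => hcap u hu c), hN u (hs.subset_verts hu), hd u huD] at h1
  have h2 := degree_induce_add (H := H) v D
  rw [hd v hvD] at h2
  have h3 := (hs.outerEdges_nonempty hconn).card_pos
  have h4 := hcr.degree_le v hs.mem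
  rw [hN v hs.mem] at h4
  omega

end Separation

end MultiHypergraph

namespace MultiHypergraph

/-! ### From good colorings to list colorings -/

section ListColoring

open Classical

variable {α β C : Type*} {H : MultiHypergraph α β} {f : α → C → ℕ} {φ : α → C}

theorem verts_nonempty (h : ¬ H.IsEmptyHypergraph) : H.verts.Nonempty := by
  by_contra hne
  rw [Finset.not_nonempty_iff_eq_empty] at hne
  refine h ⟨hne, Finset.eq_empty_iff_forall_notMem.2 fun e he => ?_⟩
  have h1 := H.inc_subset e he
  have h2 := H.two_le_card_inc e he
  rw [hne, Finset.subset_empty] at h1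
  rw [h1, Finset.card_empty] at h2
  omega

/-- Taking `X = {v}` shows that a color without capacity is never used; this is how the lists are
respected. -/
theorem GoodOn.pos {A : Finset α} (h : H.GoodOn f A φ) {v : α} (hv : v ∈ A) : 0 < f v (φ v) := by
  obtain ⟨u, hu, hlt⟩ := h {v} (Finset.singleton_subset_iff.2 hv) (Finset.singleton_nonempty v)
    (φ v) (fun u hu => by rw [Finset.mem_singleton.1 hu])
  rw [Finset.mem_singleton.1 hu] at hlt
  omega

theorem GoodOn.strictlyDegenerate (h : H.GoodOn f H.verts φ) {s : ℕ} {c : C}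
    (hs : ∀ v ∈ H.verts, f v c ≤ s) : (H.induce (H.colorClass φ c)).StrictlyDegenerate s := by
  rintro G ⟨hv, he, hi⟩ hne
  have hmem : ∀ u ∈ G.verts, u ∈ H.verts ∧ φ u = c := by
    intro u hu
    have := hv hu
    simp only [induce, colorClass, Finset.mem_filter] at this
    exact ⟨this.1, this.2.2⟩
  obtain ⟨u, hu, hlt⟩ := h G.verts (fun u hu => (hmem u hu).1) (verts_nonempty hne) c
    (fun u hu => (hmem u hu).2)
  refine ⟨u, hu, lt_of_le_of_lt (Finset.card_le_card fun e heu => ?_)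
    (hlt.trans_le (hs u (hmem u hu).1))⟩
  rw [Finset.mem_filter] at heu
  have hie : G.inc e = H.inc e := hi e heu.1
  exact Finset.mem_filter.2 ⟨(mem_edges_induce.1 (he heu.1)).1, hie ▸ heu.2,
    hie ▸ G.inc_subset e heu.1⟩

end ListColoring

end MultiHypergraph

theorem mainTheorem4 {α β C : Type*} (H : MultiHypergraph α β)
    (hconn : H.Connected)
    (hK : ∀ t n : ℕ, 1 ≤ t → 1 ≤ n → ¬ H.IsMultipleOf t (⊤ : SimpleGraph (Fin n)))
    (hC : ∀ t n : ℕ, 1 ≤ t → 3 ≤ n → Odd n → ¬ H.IsMultipleOf t (SimpleGraph.cycleGraph n))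
    (hdeg : 1 ≤ H.maxDegree)
    (k s : ℕ) (hks : H.maxDegree ≤ k * s) (hk : 2 ≤ k)
    (L : α → Set C) (hL : ∀ v ∈ H.verts, (k : ℕ∞) ≤ (L v).encard) :
    ∃ φ : α → C, (∀ v ∈ H.verts, φ v ∈ L v) ∧
      ∀ c : C, (H.induce (H.colorClass φ c)).StrictlyDegenerate s := by
  classical
  have hs : 0 < s := Nat.pos_of_mul_pos_left (hdeg.trans hks)
  -- Lists are cut down to exactly `k` colors: the total capacity must be finite and, for
  -- `Critical.nonSeparable`, the same at all vertices.
  have hsub : ∀ v, ∃ M : Finset C, v ∈ H.verts → (M : Set C) ⊆ L v ∧ M.card = k := by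
    intro v
    by_cases hv : v ∈ H.verts
    · obtain ⟨M, hML, hM⟩ := Set.exists_subset_encard_eq (hL v hv)
      have hfin : M.Finite := Set.finite_of_encard_eq_coe hM
      refine ⟨hfin.toFinset, fun _ => ⟨by simpa using hML, ?_⟩⟩
      rw [hfin.encard_eq_coe_toFinset_card] at hM
      exact_mod_cast hM
    · exact ⟨∅, fun h => absurd h hv⟩
  choose M hM using hsub
  have hvne := MultiHypergraph.verts_nonempty hconn.1
  let f : α → C → ℕ := fun v c => if c ∈ M v then s else 0
  let P : Finset C := H.verts.biUnion M
  have hsum : ∀ v ∈ H.verts, ∑ c ∈ P, f v c = k * s := by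
    intro v hv
    have hMP : M v ⊆ P := Finset.subset_biUnion_of_mem M hv
    simp only [f]
    rw [← Finset.sum_filter, Finset.filter_mem_eq_inter, Finset.inter_eq_right.2 hMP,
      Finset.sum_const, (hM v hv).2, smul_eq_mul]
  have hgood : ∃ φ : α → C, H.GoodOn f H.verts φ := by
    by_contra! hno
    have hcr : H.Critical f P := by
      refine ⟨fun v hv => ?_, fun v hv c hc => ?_, hno⟩
      · rw [hsum v hv]
        exact (Finset.le_sup (f := H.degree) hv).trans hks
      · exact if_neg fun h => hc (Finset.subset_biUnion_of_mem M hv h)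
    have hcol : ∀ v ∈ H.verts, ∀ a, ∃ b, b ≠ a ∧ 0 < f v b := by
      intro v hv a
      obtain ⟨b, hb, hba⟩ := Finset.exists_mem_ne (s := M v) (by rw [(hM v hv).2]; omega) a
      exact ⟨b, hba, by simpa only [f, if_pos hb] using hs⟩
    obtain ⟨v, hv⟩ := hvne
    obtain ⟨c, hc⟩ : (M v).Nonempty := Finset.card_pos.1 (by rw [(hM v hv).2]; omega)
    have : Nonempty C := ⟨c⟩
    have hblock : H.CriticalBlock f P := ⟨hcr, hcr.nonSeparable hconn hcol (k * s) hsum,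
      fun x hx => hconn.exists_goodOff hcr.degree_le hx, hcol⟩
    obtain ⟨t, n, ht, ⟨hn, h⟩ | ⟨hn, hodd, h⟩⟩ := hblock.isMultipleOf ⟨v, hv⟩
    · exact hK t n ht hn h
    · exact hC t n ht hn hodd h
  obtain ⟨φ, hφ⟩ := hgood
  refine ⟨φ, fun v hv => (hM v hv).1 ?_, fun c => hφ.strictlyDegenerate fun v _ => ?_⟩
  · by_contra hnot
    have := hφ.pos hv
    simp only [f, if_neg (show φ v ∉ M v from hnot)] at this
    omega
  · simp only [f]
    split_ifs <;> omega
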